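/- **Theorem (Moufang–Noether charge algebra).** Let $G$ be an analytic Moufang loop of dimension $r$: a quasigroup with unit $e$, with $(ag)(ha)=a(gh)a$, that is a real analytic manifold with analytic multiplication and inversion. Fix analytic local coordinates $g^1,\dots,g^r$ around $e$ and put $$c^i_{jk}=\frac{\partial^2(ghg^{-1}h^{-1})^i}{\partial g^j\,\partial h^k}\Big|_{g=h=e},\qquad [x,y]^i=c^i_{jk}x^jy^k,$$ $$6d^p_{jkl}=c^p_{js}c^s_{kl}-c^p_{ks}c^s_{jl}+c^p_{sl}c^s_{jk}$$ (repeated indices are summed). Let $(S,T)$ be a differentiable birepresentation of $G$: differentiable maps $S,T:G\to GL_n(\mathbb C)$ with $S_e=T_e=1$, $T_gS_gS_h=S_{gh}T_g$ and $S_gT_gT_h=T_{hg}S_g$ for all $g,h\in G$. Let $S_j=\partial S_g/\partial g^j|_{g=e}$ and $T_j=\partial T_g/\partial g^j|_{g=e}$ be its generators. Let $D$ be a complex inner product space. By an operator on $D$ we mean a linear map $D\to D$ that has an adjoint $D\to D$. Let $u^A(\cdot,t)$ and $p^0_A(\cdot,t)$, $A=1,\dots,n$, be the canonical fields and momenta at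 time $t$: linear maps from $\mathcal S(\mathbb R^m)$ to the operators on $D$, with matrix elements that are tempered distributions, satisfying the canonical equal-time relations $$[u^A(\mathbf x,t),p^0_B(\mathbf y,t)]=i\delta^A_B\,\delta(\mathbf x-\mathbf y),\qquad [u^A(\mathbf x,t),u^B(\mathbf y,t)]=0=[p^0_A(\mathbf x,t),p^0_B(\mathbf y,t)],$$ where all brackets are commutators (bosonic fields) or all are anticommutators (fermionic fields). The products of fields at a point are defined by point splitting. Let $K_\nu(\mathbf x,\mathbf y)=\sum_k f_{\nu,k}(\mathbf x)g_{\nu,k}(\mathbf y)$ (finite sums, $f_{\nu,k},g_{\nu,k}\in\mathcal S(\mathbb R^m)$) be a sequence of kernels with $K_\nu\to\delta(\mathbf x-\mathbf y)$, in the sense that the integral operators with kernel $K_\nu$ and with the transposed kernel converge pointwise on $\mathcal S(\mathbb R^m)$, in its topology, to the identity. For a matrix $M$, the charge $-i\int p^0Mu\,d\mathbf x$ is said to exist and to equal the operator $Q$ on $D$ if $$\Big\langle\varphi,\,-i\iint p^0_A(\mathbf x,t)K_\nu(\mathbf x,\mathbf y)M^A_Bu^B(\mathbf y,t)\,d\mathbf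 x\,d\mathbf y\;\psi\Big\rangle\longrightarrow\langle\varphi,Q\psi\rangle\qquad(\nu\to\infty)$$ for all $\varphi,\psi\in D$. At a time $t$, suppose that the Moufang–Noether charges $$\sigma_j=-i\int p^0S_ju\,d\mathbf x,\qquad \tau_j=-i\int p^0T_ju\,d\mathbf x,\qquad j=1,\dots,r,$$ exist, and define the Yamagutian $Y_{jk}$ by $$[\sigma_j,\tau_k]=-Y_{jk}+\tfrac13c^p_{jk}\sigma_p-\tfrac13c^p_{jk}\tau_p .$$ Then $(\sigma,\tau)$ is a birepresentation of the tangent Mal'tsev algebra $\Gamma=(T_eG,[\cdot,\cdot])$ of $G$. That is, $[\cdot,\cdot]$ is anticommutative and satisfies the Mal'tsev identity $[J(x,y,z),x]=J(x,y,[x,z])$ with $J(x,y,z)=[x,[y,z]]+[y,[z,x]]+[z,[x,y]]$, and, for all indices, in addition to the defining relation of $Y_{jk}$, $$[\sigma_j,\sigma_k]=2Y_{jk}+\tfrac13c^p_{jk}\sigma_p+\tfrac23c^p_{jk}\tau_p,\qquad [\tau_j,\tau_k]=2Y_{jk}-\tfrac23c^p_{jk}\sigma_p-\tfrac13c^p_{jk}\tau_p,$$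 $$Y_{jk}+Y_{kj}=0,\qquad c^p_{jk}Y_{pl}+c^p_{kl}Y_{pj}+c^p_{lj}Y_{pk}=0,$$ $$[Y_{jk},\sigma_l]=d^p_{jkl}\sigma_p,\qquad [Y_{jk},\tau_l]=d^p_{jkl}\tau_p,$$ $$[Y_{jk},Y_{lq}]=d^p_{jkl}Y_{pq}+d^p_{jkq}Y_{lp}.$$ -/

import Mathlib

open scoped Manifold ContDiff SchwartzMap InnerProductSpace Matrix

noncomputable section

/-! ### Analytic Moufang loops and their tangent algebras -/

/-- A Moufang loop: a quasigroup with unit satisfying `(ag)(ha) = a(gh)a`, together with its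
(two-sided) inversion. -/
class MoufangLoop (G : Type*) extends Mul G, One G, Inv G where
  one_mul' : ∀ g : G, 1 * g = g
  mul_one' : ∀ g : G, g * 1 = g
  mul_left_bijective' : ∀ a : G, Function.Bijective fun g : G => a * g
  mul_right_bijective' : ∀ a : G, Function.Bijective fun g : G => g * a
  mul_inv' : ∀ g : G, g * g⁻¹ = 1
  inv_mul' : ∀ g : G, g⁻¹ * g = 1
  moufang' : ∀ a g h : G, (a * g) * (h * a) = (a * (g * h)) * a

/-- An analytic Moufang loop of dimension `r`: a Moufang loop that is a real analytic manifold
with analytic multiplication and inversion. -/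
class IsAnalyticMoufangLoop (r : ℕ) (G : Type*) [TopologicalSpace G]
    [ChartedSpace (EuclideanSpace ℝ (Fin r)) G] [MoufangLoop G] : Prop
    extends IsManifold (𝓡 r) ω G where
  contMDiff_mul' : ContMDiff ((𝓡 r).prod (𝓡 r)) (𝓡 r) ω fun q : G × G => q.1 * q.2
  contMDiff_inv' : ContMDiff (𝓡 r) (𝓡 r) ω fun g : G => g⁻¹

/-- The point of `G` whose coordinates in the chart `φ` are those of the unit, with the `j`-th
coordinate increased by `s`. -/
def coordPoint {r : ℕ} {G : Type*} [TopologicalSpace G] [One G]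
    (φ : OpenPartialHomeomorph G (EuclideanSpace ℝ (Fin r))) (j : Fin r) (s : ℝ) : G :=
  φ.symm (φ 1 + EuclideanSpace.single j s)

/-- The structure constant `c^i_{jk} = ∂²(g h g⁻¹ h⁻¹)^i / ∂g^j ∂h^k` at `g = h = e`, in the
local coordinates given by the chart `φ`. -/
def structureConstant {r : ℕ} {G : Type*} [TopologicalSpace G] [MoufangLoop G]
    (φ : OpenPartialHomeomorph G (EuclideanSpace ℝ (Fin r))) (i j k : Fin r) : ℝ :=
  deriv (fun s : ℝ => deriv (fun t : ℝ =>
    φ (coordPoint φ j s * coordPoint φ k t * (coordPoint φ j s)⁻¹ * (coordPoint φ k t)⁻¹) i) 0) 0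

/-- The product `[x, y]^i = c^i_{jk} x^j y^k` with given structure constants. -/
def bracketOf {r : ℕ} (c : Fin r → Fin r → Fin r → ℝ) (x y : Fin r → ℝ) : Fin r → ℝ :=
  fun i => ∑ j, ∑ k, c i j k * x j * y k

/-- The Jacobian `J(x,y,z) = [x,[y,z]] + [y,[z,x]] + [z,[x,y]]`. -/
def jacobian {V : Type*} [AddCommGroup V] (b : V → V → V) (x y z : V) : V :=
  b x (b y z) + b y (b z x) + b z (b x y)

/-- The anticommutative product `b` satisfies the Mal'tsev identity
`[J(x,y,z), x] = J(x, y, [x,z])`. -/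
structure IsMaltsevBracket {V : Type*} [AddCommGroup V] (b : V → V → V) : Prop where
  anticomm : ∀ x y, b x y = -b y x
  maltsev : ∀ x y z, b (jacobian b x y z) x = jacobian b x y (b x z)

/-! ### Birepresentations of Moufang loops -/

/-- `(S, T)` is a birepresentation of the Moufang loop `G`. -/
structure IsBirepresentation {n : ℕ} {G : Type*} [MoufangLoop G] (S T : G → GL (Fin n) ℂ) :
    Prop where
  left_one : S 1 = 1
  right_one : T 1 = 1
  left_mul : ∀ g h : G, T g * S g * S h = S (g * h) * T g
  right_mul : ∀ g h : G, S g * T g * T h = T (h * g) * S g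

/-- The matrix entries of `S : G → GL_n` are (real) differentiable functions on `G`. -/
def IsDifferentiableMap (r : ℕ) {n : ℕ} {G : Type*} [TopologicalSpace G]
    [ChartedSpace (EuclideanSpace ℝ (Fin r)) G] (S : G → GL (Fin n) ℂ) : Prop :=
  ∀ A B : Fin n, MDifferentiable (𝓡 r) 𝓘(ℝ, ℂ) fun g : G => (S g : Matrix (Fin n) (Fin n) ℂ) A B

/-- The generator `S_j = ∂S_g / ∂g^j` at `g = e`, in the coordinates given by the chart `φ`. -/
def generator {r n : ℕ} {G : Type*} [TopologicalSpace G] [One G]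
    (φ : OpenPartialHomeomorph G (EuclideanSpace ℝ (Fin r))) (S : G → GL (Fin n) ℂ) (j : Fin r) :
    Matrix (Fin n) (Fin n) ℂ :=
  Matrix.of fun A B => deriv (fun s : ℝ => (S (coordPoint φ j s) : Matrix (Fin n) (Fin n) ℂ) A B) 0

/-! ### Birepresentations of Mal'tsev algebras -/

/-- The Yamaguti constants,
`6 d^p_{jkl} = c^p_{js} c^s_{kl} - c^p_{ks} c^s_{jl} + c^p_{sl} c^s_{jk}`. -/
def yamagutiConstant {r : ℕ} (c : Fin r → Fin r → Fin r → ℝ) (p j k l : Fin r) : ℝ :=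
  (∑ s, (c p j s * c s k l - c p k s * c s j l + c p s l * c s j k)) / 6

/-- The Yamagutian of the pair `(σ, τ)`, i.e. the solution `Y_{jk}` of
`[σ_j, τ_k] = -Y_{jk} + (1/3) c^p_{jk} σ_p - (1/3) c^p_{jk} τ_p`. -/
def yamagutian {r : ℕ} {A : Type*} [Ring A] [Algebra ℂ A] (c : Fin r → Fin r → Fin r → ℝ)
    (σ τ : Fin r → A) (j k : Fin r) : A :=
  -⁅σ j, τ k⁆ + (1 / 3 : ℂ) • ∑ p, (c p j k : ℂ) • σ p - (1 / 3 : ℂ) • ∑ p, (c p j k : ℂ) • τ p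

/-- The families `σ`, `τ` of elements of an associative algebra form, with Yamaguti operators `Y`,
a birepresentation of the Mal'tsev algebra with structure constants `c`. -/
structure IsMaltsevBirepresentation {r : ℕ} {A : Type*} [Ring A] [Algebra ℂ A]
    (c : Fin r → Fin r → Fin r → ℝ) (σ τ : Fin r → A) (Y : Fin r → Fin r → A) : Prop where
  isMaltsev : IsMaltsevBracket (bracketOf c)
  comm_left_left : ∀ j k, ⁅σ j, σ k⁆ =
    (2 : ℂ) • Y j k + (1 / 3 : ℂ) • ∑ p, (c p j k : ℂ) • σ p
      + (2 / 3 : ℂ) • ∑ p, (c p j k : ℂ) • τ p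
  comm_left_right : ∀ j k, ⁅σ j, τ k⁆ =
    -Y j k + (1 / 3 : ℂ) • ∑ p, (c p j k : ℂ) • σ p
      - (1 / 3 : ℂ) • ∑ p, (c p j k : ℂ) • τ p
  comm_right_right : ∀ j k, ⁅τ j, τ k⁆ =
    (2 : ℂ) • Y j k - (2 / 3 : ℂ) • ∑ p, (c p j k : ℂ) • σ p
      - (1 / 3 : ℂ) • ∑ p, (c p j k : ℂ) • τ p
  yamaguti_antisymm : ∀ j k, Y j k + Y k j = 0
  yamaguti_cyclic : ∀ j k l,
    ∑ p, ((c p j k : ℂ) • Y p l + (c p k l : ℂ) • Y p j + (c p l j : ℂ) • Y p k) = 0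
  reductivity_left : ∀ j k l, ⁅Y j k, σ l⁆ = ∑ p, (yamagutiConstant c p j k l : ℂ) • σ p
  reductivity_right : ∀ j k l, ⁅Y j k, τ l⁆ = ∑ p, (yamagutiConstant c p j k l : ℂ) • τ p
  comm_yamaguti : ∀ j k l q, ⁅Y j k, Y l q⁆ =
    ∑ p, ((yamagutiConstant c p j k l : ℂ) • Y p q + (yamagutiConstant c p j k q : ℂ) • Y l p)

/-! ### Quantum fields at a fixed time and canonical equal-time relations

The operators act on a common invariant domain `D`, a complex inner product space (its completion
is the Hilbert space of states). -/

/-- The space `ℝ^m` of spatial positions, `m = d - 1`. -/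
abbrev Space (m : ℕ) : Type := EuclideanSpace ℝ (Fin m)

/-- The operator `A` on the domain `D` has an adjoint that is also defined on, and preserves,
`D`. -/
def HasAdjointOn {D : Type*} [NormedAddCommGroup D] [InnerProductSpace ℂ D]
    (A : Module.End ℂ D) : Prop :=
  ∃ B : Module.End ℂ D, ∀ x y : D, ⟪B x, y⟫_ℂ = ⟪x, A y⟫_ℂ

/-- A field on `ℝ^m` at a fixed time: an operator-valued tempered distribution
`f ↦ ∫ f(x) u(x) dx` on the invariant domain `D`. -/
structure OperatorField (m : ℕ) (D : Type*) [NormedAddCommGroup D] [InnerProductSpace ℂ D] where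
  smear : 𝓢(Space m, ℂ) →ₗ[ℂ] Module.End ℂ D
  hasAdjoint : ∀ f, HasAdjointOn (smear f)
  continuous_matrixElement : ∀ x y : D, Continuous fun f => ⟪x, smear f y⟫_ℂ

/-- The statistics of the fields. -/
inductive FieldStatistics
  | bosonic
  | fermionic

/-- The commutator for bosonic fields, the anticommutator for fermionic ones. -/
def FieldStatistics.bracket {A : Type*} [Ring A] : FieldStatistics → A → A → A
  | .bosonic, a, b => a * b - b * a
  | .fermionic, a, b => a * b + b * a

/-- The canonical equal-time relations for the fields `u^A` and their canonical momenta `p_A`, in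
smeared form: `[u^A(x), p_B(y)] = i δ^A_B δ(x - y)`, `[u^A(x), u^B(y)] = 0`,
`[p_A(x), p_B(y)] = 0`, with anticommutators in the fermionic case. -/
structure CanonicalETC {n m : ℕ} {D : Type*} [NormedAddCommGroup D] [InnerProductSpace ℂ D]
    (stat : FieldStatistics) (u p : Fin n → OperatorField m D) : Prop where
  field_momentum : ∀ (A B : Fin n) (f g : 𝓢(Space m, ℂ)),
    stat.bracket ((u A).smear f) ((p B).smear g) =
      (if A = B then Complex.I * ∫ x, f x * g x else 0) • (1 : Module.End ℂ D)
  field_field : ∀ (A B : Fin n) (f g : 𝓢(Space m, ℂ)),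
    stat.bracket ((u A).smear f) ((u B).smear g) = 0
  momentum_momentum : ∀ (A B : Fin n) (f g : 𝓢(Space m, ℂ)),
    stat.bracket ((p A).smear f) ((p B).smear g) = 0

/-! ### Charges

The product of `p` and `u` at the same point is defined by point splitting: `δ(x - y)` in
`∫ p(x) M u(x) dx = ∫∫ p(x) δ(x - y) M u(y) dx dy` is approximated by regular kernels. -/

/-- A regular kernel `∑_k f_k(x) g_k(y)` of finite rank. -/
structure SplittingKernel (m : ℕ) where
  rank : ℕ
  left : Fin rank → 𝓢(Space m, ℂ)
  right : Fin rank → 𝓢(Space m, ℂ)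

/-- The kernels `K ν` converge to `δ(x - y)`: the integral operators defined by `K ν` and by
its transpose converge to the identity, pointwise in the Schwartz space. -/
def IsDeltaSequence {m : ℕ} (K : ℕ → SplittingKernel m) : Prop :=
  ∀ h : 𝓢(Space m, ℂ),
    Filter.Tendsto (fun ν => ∑ k, (∫ y, (K ν).right k y * h y) • (K ν).left k)
      Filter.atTop (nhds h) ∧
    Filter.Tendsto (fun ν => ∑ k, (∫ x, (K ν).left k x * h x) • (K ν).right k)
      Filter.atTop (nhds h)

/-- The regularized charge `-i ∫∫ p_A(x) K(x, y) M^A_B u^B(y) dx dy`. -/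
def splitCharge {n m : ℕ} {D : Type*} [NormedAddCommGroup D] [InnerProductSpace ℂ D]
    (K : SplittingKernel m) (p : Fin n → OperatorField m D) (M : Matrix (Fin n) (Fin n) ℂ)
    (u : Fin n → OperatorField m D) : Module.End ℂ D :=
  (-Complex.I) • ∑ k, ∑ A, ∑ B,
    M A B • ((p A).smear (K.left k) * (u B).smear (K.right k))

/-- The operator `Q` on `D` (with adjoint on `D`) is the charge `-i ∫ p(x) M u(x) dx`: the limit,
in the sense of matrix elements, of the regularized charges. -/
def IsNoetherCharge {n m : ℕ} {D : Type*} [NormedAddCommGroup D] [InnerProductSpace ℂ D]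
    (K : ℕ → SplittingKernel m) (p : Fin n → OperatorField m D) (M : Matrix (Fin n) (Fin n) ℂ)
    (u : Fin n → OperatorField m D) (Q : Module.End ℂ D) : Prop :=
  HasAdjointOn Q ∧ ∀ x y : D,
    Filter.Tendsto (fun ν => ⟪x, splitCharge (K ν) p M u y⟫_ℂ) Filter.atTop (nhds ⟪x, Q y⟫_ℂ)

end

noncomputable section

/-! ### Lie algebras with the second-order relations of a Moufang loop -/

/-! Everything rests on the three commutation relations in `IsTranslationPair`: two of them express
`⁅S x, S y⁆` and `⁅T x, T y⁆` through the product and the mixed bracket `⁅S x, T y⁆`, and the third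
makes the mixed bracket antisymmetric. In any Lie algebra these relations and the Jacobi identity
already force the whole birepresentation structure: `lie_mixed_left` and `lie_mixed_right` evaluate
the triple brackets, the Yamagutian then acts through the triple product (`lie_yamaguti_left`,
`lie_yamaguti_right`), and its adjoint action being a derivation gives the remaining identities. It
is therefore enough to prove the three relations for the charges, and the Mal'tsev identity for the
structure constants.

The relations come from differentiating the Moufang identities at the unit. One differentiation
gives first-order equations for the translations; a second gives two formulas that share an unknown
second derivative. That derivative is symmetric, so it can be eliminated
(`antisymm_of_symmetric_relations`), and exactly the translation relations remain. The argument is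
used twice. For the translations acting on functions (`IsLocalMoufangLoop.isTranslationPair`),
faithfulness of the left translations yields the Mal'tsev identity. For the matrices of the
birepresentation (`IsLocalBirepresentation.isTranslationPair`) it yields the relations of the
generators; here only differentiability is assumed, and the first-order equation itself supplies the
second derivative at the unit.

The passage to charges is `IsNoetherCharge.lie`. A charge of `M` acts on the fields by `-M` and on
the momenta by `M`, so its commutator with a regularized charge of `N` is exactly the regularized
charge of `M * N - N * M`, with no extra term. In the limit the commutator of two charges is a
charge of the commutator of the matrices, and uniqueness of limits transports the relations of the
generators to the charges. -/

/-- The commutation relations of the infinitesimal translations of a Moufang loop with tangent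
product `b`. -/
structure IsTranslationPair {M L : Type*} [AddCommGroup M] [Module ℝ M] [LieRing L]
    [LieAlgebra ℝ L] (b : M →ₗ[ℝ] M →ₗ[ℝ] M) (S T : M →ₗ[ℝ] L) : Prop where
  lie_left : ∀ x y, ⁅S x, S y⁆ = S (b x y) - (2 : ℝ) • ⁅S x, T y⁆
  lie_right : ∀ x y, ⁅T x, T y⁆ = -T (b x y) - (2 : ℝ) • ⁅S x, T y⁆
  lie_swap : ∀ x y, ⁅S x, T y⁆ = ⁅T x, S y⁆

section Abstract

variable {M L : Type*} [AddCommGroup M] [Module ℝ M] [LieRing L] [LieAlgebra ℝ L]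

/-- The cyclic sum `[[x,y],z] + [[y,z],x] + [[z,x],y]`. -/
def cyclicProduct (b : M →ₗ[ℝ] M →ₗ[ℝ] M) (x y z : M) : M :=
  b (b x y) z + b (b y z) x + b (b z x) y

/-- The Yamaguti triple product `(1/6) ([x,[y,z]] - [y,[x,z]] + [[x,y],z])`. -/
def tripleProduct (b : M →ₗ[ℝ] M →ₗ[ℝ] M) (x y z : M) : M :=
  (1 / 6 : ℝ) • (b x (b y z) - b y (b x z) + b (b x y) z)

variable {b : M →ₗ[ℝ] M →ₗ[ℝ] M} {S T : M →ₗ[ℝ] L}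

theorem tripleProduct_eq (hb : ∀ x y, b x y = -b y x) (x y z : M) :
    tripleProduct b x y z =
      (1 / 3 : ℝ) • b (b x y) z - (1 / 6 : ℝ) • cyclicProduct b x y z := by
  unfold tripleProduct cyclicProduct
  rw [hb x (b y z), hb y (b x z), hb x z]
  simp only [map_neg, LinearMap.neg_apply]
  module

/-! ### Consequences of the Jacobi identity. -/

namespace IsTranslationPair

/-- This is the passage to the opposite loop. It turns each statement about left translations into
its mirror image. -/
theorem symm (h : IsTranslationPair b S T) : IsTranslationPair (-b) T S where
  lie_left x y := by
    rw [h.lie_right, ← h.lie_swap]; simp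
  lie_right x y := by
    rw [h.lie_left, ← h.lie_swap]; simp
  lie_swap x y := (h.lie_swap x y).symm

theorem mixed_antisymm (h : IsTranslationPair b S T) (x y : M) :
    ⁅S x, T y⁆ = -⁅S y, T x⁆ := by
  rw [h.lie_swap, ← lie_skew]

/-- The Jacobi identity for `S x`, `S y`, `T z`, with `⁅S x, S y⁆` expanded by `lie_left` and the
mixed brackets put in cyclic order. -/
theorem jacobi_left_left_right (h : IsTranslationPair b S T) (x y z : M) :
    ⁅S (b x y), T z⁆ - (2 : ℝ) • ⁅⁅S x, T y⁆, T z⁆ =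
      -⁅⁅S y, T z⁆, S x⁆ - ⁅⁅S z, T x⁆, S y⁆ := by
  have := lie_jacobi (S x) (S y) (T z)
  rw [← lie_skew (S x) ⁅S y, T z⁆, ← lie_skew (T z) ⁅S x, S y⁆, h.lie_left x y,
    ← lie_skew (T z) (S x), h.mixed_antisymm x z, neg_neg,
    ← lie_skew (S y) ⁅S z, T x⁆, sub_lie,
    smul_lie] at this
  linear_combination (norm := module) -this

theorem jacobi_left (h : IsTranslationPair b S T) (x y z : M) :
    (2 : ℝ) • (⁅⁅S x, T y⁆, S z⁆ + ⁅⁅S y, T z⁆, S x⁆ + ⁅⁅S z, T x⁆, S y⁆) =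
      S (cyclicProduct b x y z) -
        (2 : ℝ) • (⁅S (b x y), T z⁆ + ⁅S (b y z), T x⁆ + ⁅S (b z x), T y⁆) := by
  have := lie_jacobi (S x) (S y) (S z)
  rw [← lie_skew (S x) ⁅S y, S z⁆, ← lie_skew (S y) ⁅S z, S x⁆, ← lie_skew (S z) ⁅S x, S y⁆,
    h.lie_left x y, h.lie_left y z, h.lie_left z x] at this
  simp only [sub_lie, smul_lie, h.lie_left (b _ _)] at this
  simp only [cyclicProduct, map_add]
  linear_combination (norm := module) this

/-- The elimination behind `lie_mixed_left`. There `a`, `b`, `c` are the cyclic shifts of `⁅⁅S x, T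
y⁆, S z⁆`, and `f`, `g`, `d` those of `⁅S (b x y), T z⁆`; `q` and `r` are the triple brackets ending
in `T x` and `T y`, and `s` is the image of the cyclic product. -/
theorem eq_of_cyclic_relations {V : Type*} [AddCommGroup V] [Module ℝ V] {f a b c d g s q r : V}
    (h2 : g - (2 : ℝ) • q = -c - a)
    (h3 : d - (2 : ℝ) • r = -a - b) (h4 : -f - (2 : ℝ) • a = -q - r)
    (h5 : (2 : ℝ) • (a + b + c) = s - (2 : ℝ) • (f + g + d)) :
    a = -f + (1 / 6 : ℝ) • s := by
  linear_combination (norm := module)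
    (-2 / 3 : ℝ) • h4 - (1 / 3 : ℝ) • h2 - (1 / 3 : ℝ) • h3 + (1 / 6 : ℝ) • h5

theorem lie_mixed_left (h : IsTranslationPair b S T) (x y z : M) :
    ⁅⁅S x, T y⁆, S z⁆ = -⁅S (b x y), T z⁆ + (1 / 6 : ℝ) • S (cyclicProduct b x y z) := by
  refine eq_of_cyclic_relations (h.jacobi_left_left_right y z x)
    (h.jacobi_left_left_right z x y) ?_ (h.jacobi_left x y z)
  have := h.symm.jacobi_left_left_right x y z
  simpa [← h.lie_swap] using this

theorem lie_mixed_right (h : IsTranslationPair b S T) (x y z : M) :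
    ⁅⁅S x, T y⁆, T z⁆ = ⁅S (b x y), T z⁆ + (1 / 6 : ℝ) • T (cyclicProduct b x y z) := by
  have := h.symm.lie_mixed_left x y z
  simpa [← h.lie_swap, cyclicProduct] using this

/-- Once the triple brackets are known, the mixed Jacobi identity becomes a condition on the mixed
brackets alone. -/
theorem cyclic_mixed (h : IsTranslationPair b S T) (x y z : M) :
    ⁅S (b x y), T z⁆ + ⁅S (b y z), T x⁆ + ⁅S (b z x), T y⁆ =
      (1 / 3 : ℝ) • (S (cyclicProduct b x y z) - T (cyclicProduct b x y z)) := by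
  have h1 := h.jacobi_left_left_right x y z
  rw [h.lie_mixed_right, h.lie_mixed_left, h.lie_mixed_left] at h1
  have e1 : cyclicProduct b y z x = cyclicProduct b x y z := by unfold cyclicProduct; abel
  have e2 : cyclicProduct b z x y = cyclicProduct b x y z := by unfold cyclicProduct; abel
  rw [e1, e2] at h1
  linear_combination (norm := module) -h1

/-- The Yamagutian of a pair of linear maps. -/
def yamaguti (b : M →ₗ[ℝ] M →ₗ[ℝ] M) (S T : M →ₗ[ℝ] L) (x y : M) : L :=
  -⁅S x, T y⁆ + (1 / 3 : ℝ) • S (b x y) - (1 / 3 : ℝ) • T (b x y)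

theorem yamaguti_antisymm (h : IsTranslationPair b S T) (hb : ∀ x y, b x y = -b y x) (x y : M) :
    yamaguti b S T x y + yamaguti b S T y x = 0 := by
  unfold yamaguti
  rw [h.mixed_antisymm x y, hb x y]
  simp only [map_neg]
  module

theorem yamaguti_cyclic (h : IsTranslationPair b S T) (x y z : M) :
    yamaguti b S T (b x y) z + yamaguti b S T (b y z) x + yamaguti b S T (b z x) y = 0 := by
  have := h.cyclic_mixed x y z
  simp only [cyclicProduct, map_add] at this
  unfold yamaguti
  linear_combination (norm := module) -this

/-- The coefficients `1/3` in the Yamagutian are those for which the terms `⁅S (b x y), T z⁆`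
cancel, with weights `1 - 2/3 - 1/3`; only values of `S` remain. -/
theorem lie_yamaguti_left (h : IsTranslationPair b S T) (hb : ∀ x y, b x y = -b y x) (x y z : M) :
    ⁅yamaguti b S T x y, S z⁆ = S (tripleProduct b x y z) := by
  rw [tripleProduct_eq hb, yamaguti]
  simp only [sub_lie, add_lie, neg_lie, smul_lie, h.lie_mixed_left, h.lie_left, ← h.lie_swap,
    map_sub, map_smul]
  module

theorem lie_yamaguti_right (h : IsTranslationPair b S T) (hb : ∀ x y, b x y = -b y x)
    (x y z : M) : ⁅yamaguti b S T x y, T z⁆ = T (tripleProduct b x y z) := by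
  rw [tripleProduct_eq hb, yamaguti]
  simp only [sub_lie, add_lie, neg_lie, smul_lie, h.lie_mixed_right, h.lie_right,
    map_sub, map_smul]
  module

/-- Apply the adjoint action of the Yamagutian, a derivation, to the relation for `⁅S z, S w⁆`; the
mixed brackets cancel. As `S` need not be injective, the conclusion holds only under `S`, which
suffices for `lie_yamaguti_yamaguti`. -/
theorem left_tripleProduct_derivation (h : IsTranslationPair b S T)
    (hb : ∀ x y, b x y = -b y x) (x y z w : M) :
    S (tripleProduct b x y (b z w)) =
      S (b (tripleProduct b x y z) w + b z (tripleProduct b x y w)) := by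
  have key := congrArg (fun A => ⁅yamaguti b S T x y, A⁆) (h.lie_left z w)
  simp only [lie_sub, lie_smul, leibniz_lie (yamaguti b S T x y) (S _) (S _),
    leibniz_lie (yamaguti b S T x y) (S _) (T _), h.lie_yamaguti_left hb,
    h.lie_yamaguti_right hb, h.lie_left (tripleProduct b x y z) w,
    h.lie_left z (tripleProduct b x y w)] at key
  rw [map_add]
  linear_combination (norm := module) -key

theorem right_tripleProduct_derivation (h : IsTranslationPair b S T)
    (hb : ∀ x y, b x y = -b y x) (x y z w : M) :
    T (tripleProduct b x y (b z w)) =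
      T (b (tripleProduct b x y z) w + b z (tripleProduct b x y w)) := by
  have := h.symm.left_tripleProduct_derivation (fun x y => by simp [hb x y]) x y z w
  have e : tripleProduct (-b) = tripleProduct b := by
    funext x y z; simp [tripleProduct]
  simp only [e, LinearMap.neg_apply, map_neg, map_add] at this ⊢
  have e2 : ∀ v, tripleProduct b x y (-v) = -tripleProduct b x y v := fun v => by
    simp only [tripleProduct, map_neg]; module
  rw [e2, map_neg] at this
  linear_combination (norm := module) -this

theorem lie_yamaguti_yamaguti (h : IsTranslationPair b S T) (hb : ∀ x y, b x y = -b y x)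
    (x y z w : M) : ⁅yamaguti b S T x y, yamaguti b S T z w⁆ =
      yamaguti b S T (tripleProduct b x y z) w + yamaguti b S T z (tripleProduct b x y w) := by
  have hS := h.left_tripleProduct_derivation hb x y z w
  have hT := h.right_tripleProduct_derivation hb x y z w
  rw [yamaguti.eq_def b S T z w]
  simp only [lie_sub, lie_add, lie_neg, lie_smul,
    leibniz_lie (yamaguti b S T x y) (S _) (T _), h.lie_yamaguti_left hb,
    h.lie_yamaguti_right hb, hS, hT]
  simp only [yamaguti, map_add]
  module

/-- If the left translations are faithful, then the product satisfies the Mal'tsev identity. -/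
theorem isMaltsevBracket (h : IsTranslationPair b S T) (hb : ∀ x y, b x y = -b y x)
    (hS : Function.Injective S) : IsMaltsevBracket (fun x y => b x y) where
  anticomm := hb
  maltsev x y z := by
    have self : ∀ v, b v v = 0 := fun v => by
      linear_combination (norm := module) (1 / 2 : ℝ) • hb v v
    -- This is the derivation property of `tripleProduct b x y`, tested on `b x z` and rewritten
    -- with Jacobians.
    have key : ∀ y z, jacobian (fun x y => b x y) x y (b x z) +
        (2 : ℝ) • jacobian (fun x y => b x y) x z (b x y) =
          b x (jacobian (fun x y => b x y) x y z) := fun y z => by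
      have d := hS (h.left_tripleProduct_derivation hb x y x z)
      simp only [tripleProduct, jacobian, self, hb y x, hb z x, map_neg, map_add, map_smul,
        LinearMap.smul_apply, LinearMap.add_apply, LinearMap.neg_apply, map_sub,
        LinearMap.sub_apply, map_zero, LinearMap.zero_apply, hb (b x y) x, hb (b x z) x,
        hb (b x z) (b x y), hb y (b x z), hb z (b x y), hb z (b x (b x y)),
        hb y (b x (b x z))] at d ⊢
      linear_combination (norm := module) (6 : ℝ) • d
    have k1 := key y z
    have k2 := key z y
    have anti : b x (jacobian (fun x y => b x y) x z y) =
        -b x (jacobian (fun x y => b x y) x y z) := by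
      simp only [jacobian]
      rw [hb z y, hb y x, hb z x]
      simp only [map_neg, map_add]
      abel
    rw [anti] at k2
    show b _ x = _
    rw [hb]
    -- `k1` and `k2` are two linear equations for `J(x,y,[x,z])` and `J(x,z,[x,y])`; this
    -- combination eliminates the second unknown.
    linear_combination (norm := module) (1 / 3 : ℝ) • k1 - (2 / 3 : ℝ) • k2

end IsTranslationPair
end Abstract

/-! ### Structure constants and generators -/

section Index

attribute [local instance] LieRing.ofAssociativeRing

variable {r : ℕ}

/-- The product `bracketOf c` as a bilinear map. -/
def bracketLinear (c : Fin r → Fin r → Fin r → ℝ) :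
    (Fin r → ℝ) →ₗ[ℝ] (Fin r → ℝ) →ₗ[ℝ] (Fin r → ℝ) :=
  LinearMap.mk₂ ℝ (bracketOf c)
    (fun x x' y => by
      funext i
      simp only [bracketOf, Pi.add_apply, ← Finset.sum_add_distrib]
      exact Finset.sum_congr rfl fun j _ => Finset.sum_congr rfl fun k _ => by ring)
    (fun a x y => by
      funext i
      simp only [bracketOf, Pi.smul_apply, smul_eq_mul, Finset.mul_sum]
      exact Finset.sum_congr rfl fun j _ => Finset.sum_congr rfl fun k _ => by ring)
    (fun x y y' => by
      funext i
      simp only [bracketOf, Pi.add_apply, ← Finset.sum_add_distrib]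
      exact Finset.sum_congr rfl fun j _ => Finset.sum_congr rfl fun k _ => by ring)
    (fun a x y => by
      funext i
      simp only [bracketOf, Pi.smul_apply, smul_eq_mul, Finset.mul_sum]
      exact Finset.sum_congr rfl fun j _ => Finset.sum_congr rfl fun k _ => by ring)

theorem bracketLinear_apply (c : Fin r → Fin r → Fin r → ℝ) (x y : Fin r → ℝ) :
    bracketLinear c x y = bracketOf c x y := rfl

theorem bracketLinear_single (c : Fin r → Fin r → Fin r → ℝ) (j k : Fin r) :
    bracketLinear c (Pi.single j 1) (Pi.single k 1) = fun i => c i j k := by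
  funext i
  simp [bracketLinear_apply, bracketOf, Pi.single_apply]

theorem bracketLinear_single_left (c : Fin r → Fin r → Fin r → ℝ) (j : Fin r) (y : Fin r → ℝ) :
    bracketLinear c (Pi.single j 1) y = fun i => ∑ k, c i j k * y k := by
  funext i
  simp [bracketLinear_apply, bracketOf, Pi.single_apply]

theorem bracketLinear_single_right (c : Fin r → Fin r → Fin r → ℝ) (x : Fin r → ℝ) (k : Fin r) :
    bracketLinear c x (Pi.single k 1) = fun i => ∑ j, c i j k * x j := by
  funext i
  simp [bracketLinear_apply, bracketOf, Pi.single_apply]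

theorem tripleProduct_single (c : Fin r → Fin r → Fin r → ℝ) (j k l : Fin r) :
    tripleProduct (bracketLinear c) (Pi.single j 1) (Pi.single k 1) (Pi.single l 1) =
      fun p => yamagutiConstant c p j k l := by
  funext p
  rw [tripleProduct, bracketLinear_single, bracketLinear_single, bracketLinear_single,
    bracketLinear_single_left, bracketLinear_single_left, bracketLinear_single_right]
  simp only [yamagutiConstant, Pi.smul_apply, Pi.add_apply, Pi.sub_apply,
    Finset.sum_add_distrib, Finset.sum_sub_distrib, smul_eq_mul]
  ring

variable {A : Type*} [Ring A] [Algebra ℂ A]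

/-- The structure constants are real and the charges lie in a complex algebra: the abstract argument
runs over the reals, and this translates its results back. -/
theorem linearCombination_eq_complex_sum (σ : Fin r → A) (x : Fin r → ℝ) :
    Fintype.linearCombination ℝ σ x = ∑ p, (x p : ℂ) • σ p := by
  simp [Fintype.linearCombination_apply]

theorem linearCombination_single_one (σ : Fin r → A) (j : Fin r) :
    Fintype.linearCombination ℝ σ (Pi.single j 1) = σ j := by
  simp

theorem one_third_smul_real (a : A) : (1 / 3 : ℂ) • a = (1 / 3 : ℝ) • a := by
  rw [← Complex.coe_smul]; norm_num

theorem yamaguti_linearCombination_single (c : Fin r → Fin r → Fin r → ℝ) (σ τ : Fin r → A)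
    (j k : Fin r) :
    IsTranslationPair.yamaguti (bracketLinear c) (Fintype.linearCombination ℝ σ)
      (Fintype.linearCombination ℝ τ) (Pi.single j 1) (Pi.single k 1) = yamagutian c σ τ j k := by
  rw [IsTranslationPair.yamaguti, yamagutian, bracketLinear_single, linearCombination_single_one,
    linearCombination_single_one, linearCombination_eq_complex_sum,
    linearCombination_eq_complex_sum, one_third_smul_real, one_third_smul_real]

theorem yamaguti_sum_left {M L : Type*} [AddCommGroup M] [Module ℝ M] [LieRing L]
    [LieAlgebra ℝ L] (b : M →ₗ[ℝ] M →ₗ[ℝ] M) (S T : M →ₗ[ℝ] L) (v : Fin r → ℝ) (e : Fin r → M)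
    (z : M) : IsTranslationPair.yamaguti b S T (∑ p, v p • e p) z =
      ∑ p, v p • IsTranslationPair.yamaguti b S T (e p) z := by
  simp only [IsTranslationPair.yamaguti, map_sum, map_smul, LinearMap.sum_apply,
    LinearMap.smul_apply, sum_lie, smul_lie, smul_sub, smul_add,
    Finset.sum_sub_distrib, Finset.sum_add_distrib, smul_neg, Finset.sum_neg_distrib,
    Finset.smul_sum, smul_comm (_ : ℝ) (1 / 3 : ℝ)]

theorem yamaguti_sum_right {M L : Type*} [AddCommGroup M] [Module ℝ M] [LieRing L]
    [LieAlgebra ℝ L] (b : M →ₗ[ℝ] M →ₗ[ℝ] M) (S T : M →ₗ[ℝ] L) (v : Fin r → ℝ) (e : Fin r → M)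
    (z : M) : IsTranslationPair.yamaguti b S T z (∑ p, v p • e p) =
      ∑ p, v p • IsTranslationPair.yamaguti b S T z (e p) := by
  simp only [IsTranslationPair.yamaguti, map_sum, map_smul,
    lie_sum, lie_smul, smul_sub, smul_add,
    Finset.sum_sub_distrib, Finset.sum_add_distrib, smul_neg, Finset.sum_neg_distrib,
    Finset.smul_sum, smul_comm (_ : ℝ) (1 / 3 : ℝ)]

theorem yamaguti_linearCombination_left (c : Fin r → Fin r → Fin r → ℝ) (σ τ : Fin r → A)
    (v : Fin r → ℝ) (k : Fin r) :
    IsTranslationPair.yamaguti (bracketLinear c) (Fintype.linearCombination ℝ σ)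
      (Fintype.linearCombination ℝ τ) v (Pi.single k 1) =
        ∑ p, (v p : ℂ) • yamagutian c σ τ p k := by
  conv_lhs => rw [pi_eq_sum_univ' v]
  rw [yamaguti_sum_left]
  exact Finset.sum_congr rfl fun p _ => by
    rw [yamaguti_linearCombination_single, Complex.coe_smul]

theorem yamaguti_linearCombination_right (c : Fin r → Fin r → Fin r → ℝ) (σ τ : Fin r → A)
    (v : Fin r → ℝ) (k : Fin r) :
    IsTranslationPair.yamaguti (bracketLinear c) (Fintype.linearCombination ℝ σ)
      (Fintype.linearCombination ℝ τ) (Pi.single k 1) v =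
        ∑ p, (v p : ℂ) • yamagutian c σ τ k p := by
  conv_lhs => rw [pi_eq_sum_univ' v]
  rw [yamaguti_sum_right]
  exact Finset.sum_congr rfl fun p _ => by
    rw [yamaguti_linearCombination_single, Complex.coe_smul]

/-- A translation pair is a birepresentation of the Mal'tsev algebra. -/
theorem IsTranslationPair.isMaltsevBirepresentation {c : Fin r → Fin r → Fin r → ℝ}
    {σ τ : Fin r → A} (hc : IsMaltsevBracket (bracketOf c))
    (h : IsTranslationPair (bracketLinear c) (Fintype.linearCombination ℝ σ)
      (Fintype.linearCombination ℝ τ)) :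
    IsMaltsevBirepresentation c σ τ (yamagutian c σ τ) where
  isMaltsev := hc
  comm_left_left j k := by
    have := h.lie_left (Pi.single j 1) (Pi.single k 1)
    rw [bracketLinear_single] at this
    simp only [linearCombination_single_one] at this
    rw [linearCombination_eq_complex_sum] at this
    rw [yamagutian]
    have e2 : ∀ a : A, (2 : ℝ) • a = (2 : ℂ) • a := fun a => by
      rw [← Complex.coe_smul]; norm_num
    rw [e2] at this
    linear_combination (norm := module) this
  comm_left_right j k := by
    rw [yamagutian]
    module
  comm_right_right j k := by
    have := h.lie_right (Pi.single j 1) (Pi.single k 1)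
    rw [bracketLinear_single] at this
    simp only [linearCombination_single_one] at this
    rw [linearCombination_eq_complex_sum] at this
    rw [yamagutian]
    have e2 : ∀ a : A, (2 : ℝ) • a = (2 : ℂ) • a := fun a => by
      rw [← Complex.coe_smul]; norm_num
    rw [e2] at this
    linear_combination (norm := module) this
  yamaguti_antisymm j k := by
    rw [← yamaguti_linearCombination_single, ← yamaguti_linearCombination_single]
    exact h.yamaguti_antisymm hc.anticomm _ _
  yamaguti_cyclic j k l := by
    have := h.yamaguti_cyclic (Pi.single j 1) (Pi.single k 1) (Pi.single l 1)
    rw [bracketLinear_single, bracketLinear_single, bracketLinear_single] at this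
    simpa only [yamaguti_linearCombination_left, Finset.sum_add_distrib] using this
  reductivity_left j k l := by
    have := h.lie_yamaguti_left hc.anticomm (Pi.single j 1) (Pi.single k 1) (Pi.single l 1)
    rwa [yamaguti_linearCombination_single, tripleProduct_single, linearCombination_single_one,
      linearCombination_eq_complex_sum] at this
  reductivity_right j k l := by
    have := h.lie_yamaguti_right hc.anticomm (Pi.single j 1) (Pi.single k 1) (Pi.single l 1)
    rwa [yamaguti_linearCombination_single, tripleProduct_single, linearCombination_single_one,
      linearCombination_eq_complex_sum] at this
  comm_yamaguti j k l q := by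
    have := h.lie_yamaguti_yamaguti hc.anticomm (Pi.single j 1) (Pi.single k 1) (Pi.single l 1)
      (Pi.single q 1)
    rwa [yamaguti_linearCombination_single, yamaguti_linearCombination_single,
      tripleProduct_single, tripleProduct_single, yamaguti_linearCombination_left,
      yamaguti_linearCombination_right, ← Finset.sum_add_distrib] at this

end Index

/-! ### Algebra of charges -/

section Charges

attribute [local instance] LieRing.ofAssociativeRing

variable {D : Type*} [NormedAddCommGroup D] [InnerProductSpace ℂ D]

theorem HasAdjointOn.mul {A B : Module.End ℂ D} (hA : HasAdjointOn A) (hB : HasAdjointOn B) :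
    HasAdjointOn (A * B) := by
  obtain ⟨A', hA⟩ := hA
  obtain ⟨B', hB⟩ := hB
  exact ⟨B' * A', fun x y => by simp [hA, hB]⟩

theorem HasAdjointOn.add {A B : Module.End ℂ D} (hA : HasAdjointOn A) (hB : HasAdjointOn B) :
    HasAdjointOn (A + B) := by
  obtain ⟨A', hA⟩ := hA
  obtain ⟨B', hB⟩ := hB
  exact ⟨A' + B', fun x y => by
    simp only [LinearMap.add_apply, inner_add_left, inner_add_right, hA, hB]⟩

theorem HasAdjointOn.smul {A : Module.End ℂ D} (hA : HasAdjointOn A) (a : ℂ) :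
    HasAdjointOn (a • A) := by
  obtain ⟨A', hA⟩ := hA
  exact ⟨(starRingEnd ℂ a) • A', fun x y => by
    simp only [LinearMap.smul_apply, inner_smul_left, inner_smul_right, hA, Complex.conj_conj]⟩

theorem HasAdjointOn.sub {A B : Module.End ℂ D} (hA : HasAdjointOn A) (hB : HasAdjointOn B) :
    HasAdjointOn (A - B) := by
  have := hA.add (hB.smul (-1))
  rwa [neg_one_smul, ← sub_eq_add_neg] at this

/-- A product of two fields behaves as an even element. The argument order in `stat.bracket c a`
makes one formula serve both statistics, and nowhere else are the two cases separated. -/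
theorem FieldStatistics.commutator_mul {A : Type*} [Ring A] (stat : FieldStatistics)
    (a b c : A) : a * b * c - c * (a * b) = a * stat.bracket b c - stat.bracket c a * b := by
  cases stat <;> simp only [FieldStatistics.bracket] <;> noncomm_ring

variable {n m : ℕ} {stat : FieldStatistics} {u p : Fin n → OperatorField m D}
  {K : ℕ → SplittingKernel m} {M N : Matrix (Fin n) (Fin n) ℂ} {Q Q' : Module.End ℂ D}

theorem splitCharge_commutator (κ : SplittingKernel m) (V : Module.End ℂ D) :
    splitCharge κ p M u * V - V * splitCharge κ p M u =
      (-Complex.I) • ∑ k, ∑ A, ∑ B, M A B •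
        ((p A).smear (κ.left k) * stat.bracket ((u B).smear (κ.right k)) V -
          stat.bracket V ((p A).smear (κ.left k)) * (u B).smear (κ.right k)) := by
  simp only [splitCharge, smul_mul_assoc, mul_smul_comm, Finset.sum_mul, Finset.mul_sum,
    ← smul_sub, ← Finset.sum_sub_distrib, stat.commutator_mul]

/-- Only the contraction with the momentum factor survives. It replaces `f` by its image under the
transposed kernel, and the two factors `I` combine to a real sign. -/
theorem CanonicalETC.splitCharge_field (h : CanonicalETC stat u p) (κ : SplittingKernel m)
    (C : Fin n) (f : 𝓢(Space m, ℂ)) :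
    splitCharge κ p M u * (u C).smear f - (u C).smear f * splitCharge κ p M u =
      -∑ B, M C B • (u B).smear (∑ k, (∫ x, κ.left k x * f x) • κ.right k) := by
  rw [splitCharge_commutator (stat := stat)]
  simp only [h.field_field, h.field_momentum, mul_zero, zero_sub, smul_neg,
    Finset.sum_neg_distrib, map_sum, map_smul]
  simp only [Finset.smul_sum]
  rw [Finset.sum_comm]
  simp only [ite_smul, zero_smul, ite_mul, zero_mul, smul_ite, smul_zero, smul_mul_assoc, one_mul,
    Finset.sum_ite_irrel, Finset.sum_const_zero, Finset.sum_ite_eq, Finset.mem_univ, if_true]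
  rw [Finset.sum_comm]
  refine congrArg _ (Finset.sum_congr rfl fun B _ => Finset.sum_congr rfl fun k _ => ?_)
  simp only [smul_smul, mul_comm (f _)]
  congr 1
  linear_combination (-M C B * ∫ x, κ.left k x * f x) * Complex.I_mul_I

theorem CanonicalETC.splitCharge_momentum (h : CanonicalETC stat u p) (κ : SplittingKernel m)
    (C : Fin n) (f : 𝓢(Space m, ℂ)) :
    splitCharge κ p M u * (p C).smear f - (p C).smear f * splitCharge κ p M u =
      ∑ A, M A C • (p A).smear (∑ k, (∫ x, κ.right k x * f x) • κ.left k) := by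
  rw [splitCharge_commutator (stat := stat)]
  simp only [h.momentum_momentum, h.field_momentum, zero_mul, sub_zero, map_sum, map_smul]
  simp only [ite_smul, zero_smul, mul_ite, mul_zero, smul_ite, smul_zero, mul_smul_comm, mul_one,
    Finset.sum_ite_eq', Finset.mem_univ, if_true, Finset.smul_sum]
  rw [Finset.sum_comm]
  refine Finset.sum_congr rfl fun A _ => Finset.sum_congr rfl fun k _ => ?_
  simp only [smul_smul]
  congr 1
  linear_combination (-M A C * ∫ x, κ.right k x * f x) * Complex.I_mul_I

/-! ### Limits of regularized charges and commutators of charges. -/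

theorem IsNoetherCharge.unique (h : IsNoetherCharge K p M u Q) (h' : IsNoetherCharge K p M u Q') :
    Q = Q' := by
  ext y
  refine ext_inner_left ℂ fun x => ?_
  exact tendsto_nhds_unique (h.2 x y) (h'.2 x y)

/-- Convergence is known for matrix elements only, so a factor standing to the left of the charge
has to be moved to the other side of the inner product. This is what adjoints on `D` are needed for.
-/
theorem IsNoetherCharge.tendsto_commutator (h : IsNoetherCharge K p M u Q) {V : Module.End ℂ D}
    (hV : HasAdjointOn V) (x y : D) :
    Filter.Tendsto (fun ν => ⟪x, (splitCharge (K ν) p M u * V - V * splitCharge (K ν) p M u) y⟫_ℂ)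
      Filter.atTop (nhds ⟪x, (Q * V - V * Q) y⟫_ℂ) := by
  obtain ⟨V', hV⟩ := hV
  have := (h.2 x (V y)).sub (h.2 (V' x) y)
  simpa only [LinearMap.sub_apply, Module.End.mul_apply, inner_sub_right, ← hV] using this

theorem OperatorField.tendsto_sum_smear {F : Fin n → OperatorField m D}
    {f : ℕ → 𝓢(Space m, ℂ)} {g : 𝓢(Space m, ℂ)} (hf : Filter.Tendsto f Filter.atTop (nhds g))
    (a : Fin n → ℂ) (x y : D) :
    Filter.Tendsto (fun ν => ⟪x, (∑ B, a B • (F B).smear (f ν)) y⟫_ℂ) Filter.atTop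
      (nhds ⟪x, (∑ B, a B • (F B).smear g) y⟫_ℂ) := by
  simp only [LinearMap.sum_apply, LinearMap.smul_apply, inner_sum, inner_smul_right]
  refine tendsto_finsetSum _ fun B _ => Filter.Tendsto.const_mul _ ?_
  exact (((F B).continuous_matrixElement x y).tendsto g).comp hf

/-- The regularized commutator is a combination of fields smeared with images of `f` under the
kernels; these tend to `f`, and matrix elements of fields are continuous. -/
theorem IsNoetherCharge.commutator_field (h : IsNoetherCharge K p M u Q)
    (hETC : CanonicalETC stat u p) (hK : IsDeltaSequence K) (C : Fin n) (f : 𝓢(Space m, ℂ)) :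
    Q * (u C).smear f - (u C).smear f * Q = -∑ B, M C B • (u B).smear f := by
  ext y
  refine ext_inner_left ℂ fun x => ?_
  refine tendsto_nhds_unique (h.tendsto_commutator ((u C).hasAdjoint f) x y) ?_
  have := (OperatorField.tendsto_sum_smear (F := u) (hK f).2 (M C) x y).neg
  simpa only [hETC.splitCharge_field, LinearMap.neg_apply, inner_neg_right] using this

theorem IsNoetherCharge.commutator_momentum (h : IsNoetherCharge K p M u Q)
    (hETC : CanonicalETC stat u p) (hK : IsDeltaSequence K) (C : Fin n) (f : 𝓢(Space m, ℂ)) :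
    Q * (p C).smear f - (p C).smear f * Q = ∑ A, M A C • (p A).smear f := by
  ext y
  refine ext_inner_left ℂ fun x => ?_
  refine tendsto_nhds_unique (h.tendsto_commutator ((p C).hasAdjoint f) x y) ?_
  have := OperatorField.tendsto_sum_smear (F := p) (hK f).1 (fun A => M A C) x y
  simpa only [hETC.splitCharge_momentum] using this

/-- By the Leibniz rule `Q` acts on each factor while the smearing functions stay the same. The
identity is exact for every kernel `κ`, so no central term arises. -/
theorem IsNoetherCharge.commutator_splitCharge (h : IsNoetherCharge K p M u Q)
    (hETC : CanonicalETC stat u p) (hK : IsDeltaSequence K) (κ : SplittingKernel m) :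
    Q * splitCharge κ p N u - splitCharge κ p N u * Q = splitCharge κ p (M * N - N * M) u := by
  have key : ∀ a b : Module.End ℂ D, Q * (a * b) - a * b * Q =
      (Q * a - a * Q) * b + a * (Q * b - b * Q) := fun a b => by noncomm_ring
  simp only [splitCharge, smul_mul_assoc, mul_smul_comm, Finset.sum_mul, Finset.mul_sum,
    ← smul_sub, ← Finset.sum_sub_distrib, key, h.commutator_field hETC hK,
    h.commutator_momentum hETC hK]
  refine congrArg _ (Finset.sum_congr rfl fun k _ => ?_)
  simp only [smul_add, mul_neg, smul_neg, Finset.sum_add_distrib, Finset.smul_sum,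
    Finset.sum_neg_distrib, Matrix.sub_apply, sub_smul, Finset.sum_sub_distrib, Matrix.mul_apply,
    Finset.sum_smul, smul_smul, mul_smul_comm, Finset.mul_sum]
  rw [← sub_eq_add_neg]
  congr 1
  -- The index `A` is the one contracted in `M * N`, so its sum is moved innermost.
  · calc _ = ∑ B, ∑ A, ∑ A', (N A B * M A' A) •
          ((p A').smear (κ.left k) * (u B).smear (κ.right k)) := Finset.sum_comm
      _ = ∑ B, ∑ A', ∑ A, (N A B * M A' A) •
          ((p A').smear (κ.left k) * (u B).smear (κ.right k)) :=
        Finset.sum_congr rfl fun B _ => Finset.sum_comm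
      _ = _ := by
        rw [Finset.sum_comm]
        simp only [mul_comm]
  · exact Finset.sum_congr rfl fun A _ => Finset.sum_comm

/-- Existence of a charge for the matrix commutator is a conclusion: one charge is kept exact, the
other is regularized, and then the limit is taken. -/
theorem IsNoetherCharge.lie (h : IsNoetherCharge K p M u Q) (h' : IsNoetherCharge K p N u Q')
    (hETC : CanonicalETC stat u p) (hK : IsDeltaSequence K) :
    IsNoetherCharge K p ⁅M, N⁆ u ⁅Q, Q'⁆ := by
  refine ⟨(h.1.mul h'.1).sub (h'.1.mul h.1), fun x y => ?_⟩
  have := (h'.tendsto_commutator h.1 x y).neg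
  rw [← inner_neg_right, ← LinearMap.neg_apply, neg_sub] at this
  refine this.congr fun ν => ?_
  rw [← inner_neg_right, ← LinearMap.neg_apply, neg_sub, h.commutator_splitCharge hETC hK,
    Ring.lie_def]

theorem IsNoetherCharge.add (h : IsNoetherCharge K p M u Q) (h' : IsNoetherCharge K p N u Q') :
    IsNoetherCharge K p (M + N) u (Q + Q') := by
  refine ⟨h.1.add h'.1, fun x y => ?_⟩
  have := (h.2 x y).add (h'.2 x y)
  simp only [← inner_add_right, ← LinearMap.add_apply] at this
  refine this.congr fun ν => ?_
  simp only [splitCharge, Matrix.add_apply, add_smul, Finset.sum_add_distrib, smul_add]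

theorem IsNoetherCharge.smul (h : IsNoetherCharge K p M u Q) (a : ℂ) :
    IsNoetherCharge K p (a • M) u (a • Q) := by
  refine ⟨h.1.smul a, fun x y => ?_⟩
  have := (h.2 x y).const_mul a
  simp only [← inner_smul_right, ← LinearMap.smul_apply] at this
  refine this.congr fun ν => ?_
  simp only [splitCharge, Matrix.smul_apply, smul_eq_mul, mul_smul, ← Finset.smul_sum,
    smul_comm (-Complex.I) a]

theorem IsNoetherCharge.real_smul (h : IsNoetherCharge K p M u Q) (a : ℝ) :
    IsNoetherCharge K p (a • M) u (a • Q) := by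
  simpa only [Complex.coe_smul] using h.smul (a : ℂ)

theorem IsNoetherCharge.sub (h : IsNoetherCharge K p M u Q) (h' : IsNoetherCharge K p N u Q') :
    IsNoetherCharge K p (M - N) u (Q - Q') := by
  simpa only [neg_one_smul, ← sub_eq_add_neg] using h.add (h'.smul (-1))

theorem IsNoetherCharge.zero : IsNoetherCharge K p 0 u (0 : Module.End ℂ D) :=
  ⟨⟨0, fun x y => by simp⟩, fun x y => by simp [splitCharge]⟩

theorem IsNoetherCharge.linearCombination {r : ℕ} {s : Fin r → Matrix (Fin n) (Fin n) ℂ}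
    {σ : Fin r → Module.End ℂ D} (h : ∀ j, IsNoetherCharge K p (s j) u (σ j)) (x : Fin r → ℝ) :
    IsNoetherCharge K p (Fintype.linearCombination ℝ s x) u
      (Fintype.linearCombination ℝ σ x) := by
  simp only [Fintype.linearCombination_apply]
  induction (Finset.univ : Finset (Fin r)) using Finset.induction_on with
  | empty => simpa using IsNoetherCharge.zero
  | insert j t hj ih =>
    rw [Finset.sum_insert hj, Finset.sum_insert hj]
    exact ((h j).real_smul _).add ih

/-- The charges of matrices satisfying the translation relations satisfy them too. -/
theorem IsTranslationPair.of_charges {r : ℕ}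
    {b : (Fin r → ℝ) →ₗ[ℝ] (Fin r → ℝ) →ₗ[ℝ] (Fin r → ℝ)}
    {s t : Fin r → Matrix (Fin n) (Fin n) ℂ} {σ τ : Fin r → Module.End ℂ D}
    (hst : IsTranslationPair b (Fintype.linearCombination ℝ s) (Fintype.linearCombination ℝ t))
    (hETC : CanonicalETC stat u p) (hK : IsDeltaSequence K)
    (hσ : ∀ j, IsNoetherCharge K p (s j) u (σ j)) (hτ : ∀ j, IsNoetherCharge K p (t j) u (τ j)) :
    IsTranslationPair b (Fintype.linearCombination ℝ σ) (Fintype.linearCombination ℝ τ) := by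
  have hs := IsNoetherCharge.linearCombination hσ
  have ht := IsNoetherCharge.linearCombination hτ
  have hst' := fun x y => (hs x).lie (ht y) hETC hK
  refine ⟨fun x y => ?_, fun x y => ?_, fun x y => ?_⟩
  -- Both sides are charges of the same matrix, hence equal.
  · have h1 := (hs x).lie (hs y) hETC hK
    rw [hst.lie_left] at h1
    exact h1.unique ((hs _).sub ((hst' x y).real_smul 2))
  · have h1 := (ht x).lie (ht y) hETC hK
    rw [hst.lie_right, ← map_neg] at h1
    rw [← map_neg]
    exact h1.unique ((ht _).sub ((hst' x y).real_smul 2))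
  · have h1 := hst' x y
    rw [hst.lie_swap] at h1
    exact h1.unique ((ht x).lie (hs y) hETC hK)

end Charges

/-! ### Identities in Moufang loops -/

namespace MoufangLoop

variable {G : Type*} [MoufangLoop G]

theorem mul_left_cancel' {a g h : G} (e : a * g = a * h) : g = h := (mul_left_bijective' a).1 e

theorem mul_right_cancel' {a g h : G} (e : g * a = h * a) : g = h := (mul_right_bijective' a).1 e

theorem flexible (a g : G) : a * (g * a) = (a * g) * a := by
  have := moufang' a 1 g
  rwa [mul_one', one_mul'] at this

theorem mul_inv_cancel_left' (a g : G) : a * (a⁻¹ * g) = g := by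
  have := moufang' a a⁻¹ g
  rw [mul_inv', one_mul'] at this
  exact (mul_right_cancel' this).symm

theorem inv_mul_cancel_right' (a g : G) : (g * a⁻¹) * a = g := by
  have := moufang' a g a⁻¹
  rw [inv_mul', mul_one', ← flexible] at this
  exact (mul_left_cancel' this).symm

theorem inv_inv' (a : G) : a⁻¹⁻¹ = a := by
  apply mul_left_cancel' (a := a⁻¹)
  rw [mul_inv', inv_mul']

theorem inv_mul_cancel_left' (a g : G) : a⁻¹ * (a * g) = g := by
  simpa only [inv_inv'] using mul_inv_cancel_left' a⁻¹ g

theorem mul_inv_cancel_right' (a g : G) : (g * a) * a⁻¹ = g := by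
  simpa only [inv_inv'] using inv_mul_cancel_right' a⁻¹ g

theorem mul_inv_rev' (g h : G) : (g * h)⁻¹ = h⁻¹ * g⁻¹ := by
  have h1 : g⁻¹ = h * (g * h)⁻¹ := by
    apply mul_right_cancel' (a := g * h)
    rw [inv_mul_cancel_right', inv_mul_cancel_left']
  rw [h1, inv_mul_cancel_left']

theorem mul_mul_mul_left (g h x : G) : (g * (h * x)) * g = (g * h) * (x * g) :=
  (moufang' g h x).symm

/-- Dividing the middle Moufang identity by its left factor, with the inverse of a product reversed,
gives `key`; taking `a = h * g` there turns it into the one-sided identity. -/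
theorem right_moufang (h g x : G) : ((h * g) * x) * g = h * (g * (x * g)) := by
  have key : ∀ a w : G, (a * g⁻¹) * ((g * w) * g) = (a * w) * g := fun a w => by
    have := mul_mul_mul_left g a⁻¹ (a * w)
    rw [inv_mul_cancel_left'] at this
    have e : a * g⁻¹ = (g * a⁻¹)⁻¹ := by rw [mul_inv_rev', inv_inv']
    rw [this, e, inv_mul_cancel_left']
  have := key (h * g) x
  rw [mul_inv_cancel_right'] at this
  rw [flexible, this]

/-- The image of the right identity under inversion. -/
theorem left_moufang (h g x : G) : g * (x * (g * h)) = ((g * x) * g) * h := by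
  have := congrArg (·⁻¹) (right_moufang h⁻¹ g⁻¹ x⁻¹)
  simpa only [mul_inv_rev', inv_inv'] using this

variable {H : Type*} [Group H] {S T : G → H}

theorem birepresentation_inv (hS1 : S 1 = 1) (hS : ∀ g h : G, T g * S g * S h = S (g * h) * T g)
    (g : G) : S g⁻¹ = (S g)⁻¹ := by
  have := hS g g⁻¹
  rw [mul_inv', hS1, one_mul, mul_assoc] at this
  exact eq_inv_of_mul_eq_one_right (mul_eq_left.mp this)

theorem birepresentation_inv' (hT1 : T 1 = 1) (hT : ∀ g h : G, S g * T g * T h = T (h * g) * S g)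
    (g : G) : T g⁻¹ = (T g)⁻¹ := by
  have := hT g g⁻¹
  rw [inv_mul', hT1, one_mul, mul_assoc] at this
  exact eq_inv_of_mul_eq_one_right (mul_eq_left.mp this)

theorem birepresentation_comm (hS1 : S 1 = 1) (hS : ∀ g h : G, T g * S g * S h = S (g * h) * T g)
    (g : G) : T g * S g = S g * T g := by
  have := hS g 1
  rwa [hS1, mul_one, mul_one'] at this

/-- Take the defining relation at inverses and invert it. The distinguished element now multiplies
on the right, so `S` can be differentiated along right translations. -/
theorem birepresentation_right_mul (hS1 : S 1 = 1) (hT1 : T 1 = 1)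
    (hS : ∀ g h : G, T g * S g * S h = S (g * h) * T g)
    (hT : ∀ g h : G, S g * T g * T h = T (h * g) * S g) (g h : G) :
    T g * S (h * g) = S h * (T g * S g) := by
  have := hS g⁻¹ h⁻¹
  rw [← mul_inv_rev', birepresentation_inv hS1 hS, birepresentation_inv hS1 hS,
    birepresentation_inv hS1 hS, birepresentation_inv' hT1 hT] at this
  have := congrArg (·⁻¹) this
  simp only [mul_inv_rev, inv_inv] at this
  rw [← this, birepresentation_comm hS1 hS]

theorem birepresentation_left_mul (hS1 : S 1 = 1) (hT1 : T 1 = 1)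
    (hS : ∀ g h : G, T g * S g * S h = S (g * h) * T g)
    (hT : ∀ g h : G, S g * T g * T h = T (h * g) * S g) (g h : G) :
    S g * T (g * h) = T h * (S g * T g) := by
  have := hT g⁻¹ h⁻¹
  rw [← mul_inv_rev', birepresentation_inv hS1 hS, birepresentation_inv' hT1 hT,
    birepresentation_inv' hT1 hT, birepresentation_inv' hT1 hT] at this
  have := congrArg (·⁻¹) this
  simp only [mul_inv_rev, inv_inv] at this
  rw [← this, birepresentation_comm hS1 hS]

end MoufangLoop

/-! ### Infinitesimal translations of a local Moufang loop -/

section LocalLoop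

open Filter Topology

variable {V : Type*} [NormedAddCommGroup V] [NormedSpace ℝ V]

/-- A smooth local Moufang loop on the open set `U` of a normed space, with unit `e`. The Moufang
identities are required near `e` in two of the variables. -/
structure IsLocalMoufangLoop (m : V × V → V) (U : Set V) (e : V) : Prop where
  isOpen : IsOpen U
  mem : e ∈ U
  contDiffAt_left : ∀ p ∈ U, ContDiffAt ℝ ∞ m (e, p)
  contDiffAt_right : ∀ p ∈ U, ContDiffAt ℝ ∞ m (p, e)
  one_mul : ∀ p ∈ U, m (e, p) = p
  mul_one : ∀ p ∈ U, m (p, e) = p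
  middle : ∀ p ∈ U, ∀ᶠ z : V × V in 𝓝 (e, e),
    m (m (z.2, m (z.1, p)), z.2) = m (m (z.2, z.1), m (p, z.2))
  middle' : ∀ p ∈ U, ∀ᶠ z : V × V in 𝓝 (e, e),
    m (z.2, m (m (p, z.1), z.2)) = m (m (z.2, p), m (z.1, z.2))
  right : ∀ p ∈ U, ∀ᶠ z : V × V in 𝓝 (e, e),
    m (m (m (z.1, z.2), p), z.2) = m (z.1, m (z.2, m (p, z.2)))
  left : ∀ p ∈ U, ∀ᶠ z : V × V in 𝓝 (e, e),
    m (z.2, m (p, m (z.2, z.1))) = m (m (m (z.2, p), z.2), z.1)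

/-- The infinitesimal left translation `x ↦ ∂(h p)/∂h` at `h = e` in direction `x`. -/
def leftTranslation (m : V × V → V) (e p : V) : V →L[ℝ] V :=
  (fderiv ℝ m (e, p)).comp (ContinuousLinearMap.inl ℝ V V)

/-- The infinitesimal right translation `x ↦ ∂(p h)/∂h` at `h = e` in direction `x`. -/
def rightTranslation (m : V × V → V) (e p : V) : V →L[ℝ] V :=
  (fderiv ℝ m (p, e)).comp (ContinuousLinearMap.inr ℝ V V)

/-- The mixed second derivative `∂²(g h)/∂g∂h` at the unit. -/
def mixedDerivative (m : V × V → V) (e x y : V) : V :=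
  fderiv ℝ (fderiv ℝ m) (e, e) (0, y) (x, 0)

theorem leftTranslation_apply (m : V × V → V) (e p x : V) :
    leftTranslation m e p x = fderiv ℝ m (e, p) (x, 0) := rfl

theorem rightTranslation_apply (m : V × V → V) (e p x : V) :
    rightTranslation m e p x = fderiv ℝ m (p, e) (0, x) := rfl

theorem leftTranslation_comp_swap (m : V × V → V) (e p : V) :
    leftTranslation (m ∘ Prod.swap) e p = rightTranslation m e p := by
  ext x
  rw [leftTranslation_apply, rightTranslation_apply]
  exact congrArg (fun A : V × V →L[ℝ] V => A (x, 0))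
    ((ContinuousLinearEquiv.prodComm ℝ V V).comp_right_fderiv (f := m) (x := (e, p)))

theorem rightTranslation_comp_swap (m : V × V → V) (e p : V) :
    rightTranslation (m ∘ Prod.swap) e p = leftTranslation m e p := by
  ext x
  rw [leftTranslation_apply, rightTranslation_apply]
  exact congrArg (fun A : V × V →L[ℝ] V => A (0, x))
    ((ContinuousLinearEquiv.prodComm ℝ V V).comp_right_fderiv (f := m) (x := (p, e)))

theorem ContDiffAt.hasFDerivAt_fderiv {E F : Type*} [NormedAddCommGroup E] [NormedSpace ℝ E]
    [NormedAddCommGroup F] [NormedSpace ℝ F] {f : E → F} {x : E} (hf : ContDiffAt ℝ ∞ f x) :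
    HasFDerivAt (fderiv ℝ f) (fderiv ℝ (fderiv ℝ f) x) x :=
  ((hf.fderiv_right (m := 1) (by norm_cast)).differentiableAt one_ne_zero).hasFDerivAt

theorem ContDiffAt.fderiv_fderiv_symm {E F : Type*} [NormedAddCommGroup E] [NormedSpace ℝ E]
    [NormedAddCommGroup F] [NormedSpace ℝ F] {f : E → F} {x : E} (hf : ContDiffAt ℝ ∞ f x)
    (v w : E) : fderiv ℝ (fderiv ℝ f) x v w = fderiv ℝ (fderiv ℝ f) x w v :=
  (hf.isSymmSndFDerivAt (by simpa using WithTop.coe_le_coe.2 (le_top : (2 : ℕ∞) ≤ ⊤))).eq v w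

namespace IsLocalMoufangLoop

variable {m : V × V → V} {U : Set V} {e p : V}

/-- The four identities are exchanged in pairs by passing to the opposite multiplication, so
right-hand statements follow from left-hand ones. -/
theorem swap (h : IsLocalMoufangLoop m U e) : IsLocalMoufangLoop (m ∘ Prod.swap) U e where
  isOpen := h.isOpen
  mem := h.mem
  contDiffAt_left p hp := (h.contDiffAt_right p hp).comp (e, p)
    (ContinuousLinearEquiv.prodComm ℝ V V).contDiff.contDiffAt
  contDiffAt_right p hp := (h.contDiffAt_left p hp).comp (p, e)
    (ContinuousLinearEquiv.prodComm ℝ V V).contDiff.contDiffAt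
  one_mul := h.mul_one
  mul_one := h.one_mul
  middle := h.middle'
  middle' := h.middle
  right := h.left
  left := h.right

theorem hasFDerivAt_left (h : IsLocalMoufangLoop m U e) (hp : p ∈ U) :
    HasFDerivAt m (fderiv ℝ m (e, p)) (e, p) :=
  ((h.contDiffAt_left p hp).differentiableAt (by simp)).hasFDerivAt

theorem hasFDerivAt_right (h : IsLocalMoufangLoop m U e) (hp : p ∈ U) :
    HasFDerivAt m (fderiv ℝ m (p, e)) (p, e) :=
  ((h.contDiffAt_right p hp).differentiableAt (by simp)).hasFDerivAt

theorem mem_nhds (h : IsLocalMoufangLoop m U e) (hp : p ∈ U) : U ∈ 𝓝 p := h.isOpen.mem_nhds hp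

theorem hasFDerivAt_mul_left (h : IsLocalMoufangLoop m U e) (hp : p ∈ U) :
    HasFDerivAt (fun g => m (g, p)) (leftTranslation m e p) e :=
  (h.hasFDerivAt_left hp).comp e (hasFDerivAt_prodMk_left e p)

theorem hasFDerivAt_mul_right (h : IsLocalMoufangLoop m U e) (hp : p ∈ U) :
    HasFDerivAt (fun g => m (p, g)) (rightTranslation m e p) e :=
  (h.hasFDerivAt_right hp).comp e (hasFDerivAt_prodMk_right p e)

theorem fderiv_left_snd (h : IsLocalMoufangLoop m U e) (hp : p ∈ U) (v : V) :
    fderiv ℝ m (e, p) (0, v) = v := by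
  have h1 : HasFDerivAt (fun q => m (e, q))
      ((fderiv ℝ m (e, p)).comp (ContinuousLinearMap.inr ℝ V V)) p :=
    (h.hasFDerivAt_left hp).comp p (hasFDerivAt_prodMk_right e p)
  have h2 : HasFDerivAt (fun q => m (e, q)) (ContinuousLinearMap.id ℝ V) p :=
    (hasFDerivAt_id p).congr_of_eventuallyEq
      (Filter.mem_of_superset (h.mem_nhds hp) fun q hq => h.one_mul q hq)
  exact congrArg (fun A : V →L[ℝ] V => A v) (h1.unique h2)

theorem fderiv_right_fst (h : IsLocalMoufangLoop m U e) (hp : p ∈ U) (v : V) :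
    fderiv ℝ m (p, e) (v, 0) = v := by
  have h1 : HasFDerivAt (fun q => m (q, e))
      ((fderiv ℝ m (p, e)).comp (ContinuousLinearMap.inl ℝ V V)) p :=
    (h.hasFDerivAt_right hp).comp p (hasFDerivAt_prodMk_left p e)
  have h2 : HasFDerivAt (fun q => m (q, e)) (ContinuousLinearMap.id ℝ V) p :=
    (hasFDerivAt_id p).congr_of_eventuallyEq
      (Filter.mem_of_superset (h.mem_nhds hp) fun q hq => h.mul_one q hq)
  exact congrArg (fun A : V →L[ℝ] V => A v) (h1.unique h2)

theorem leftTranslation_one (h : IsLocalMoufangLoop m U e) (x : V) :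
    leftTranslation m e e x = x := h.fderiv_right_fst h.mem x

theorem rightTranslation_one (h : IsLocalMoufangLoop m U e) (x : V) :
    rightTranslation m e e x = x := h.fderiv_left_snd h.mem x

theorem fderiv_left (h : IsLocalMoufangLoop m U e) (hp : p ∈ U) (x v : V) :
    fderiv ℝ m (e, p) (x, v) = leftTranslation m e p x + v := by
  have : ((x, v) : V × V) = (x, 0) + (0, v) := by simp
  rw [this, map_add, h.fderiv_left_snd hp, leftTranslation_apply]

theorem fderiv_right (h : IsLocalMoufangLoop m U e) (hp : p ∈ U) (v x : V) :
    fderiv ℝ m (p, e) (v, x) = v + rightTranslation m e p x := by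
  have : ((v, x) : V × V) = (v, 0) + (0, x) := by simp
  rw [this, map_add, h.fderiv_right_fst hp, rightTranslation_apply]

theorem contDiffOn_leftTranslation (h : IsLocalMoufangLoop m U e) :
    ContDiffOn ℝ ∞ (leftTranslation m e) U := fun p hp => by
  refine ContDiffAt.contDiffWithinAt ?_
  have h1 := (h.contDiffAt_left p hp).fderiv_right (m := ∞) (by norm_cast)
  exact (h1.comp p (contDiffAt_const.prodMk contDiffAt_id)).clm_comp contDiffAt_const

theorem contDiffOn_rightTranslation (h : IsLocalMoufangLoop m U e) :
    ContDiffOn ℝ ∞ (rightTranslation m e) U := by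
  have := h.swap.contDiffOn_leftTranslation
  simpa only [funext (leftTranslation_comp_swap m e)] using this

theorem hasFDerivAt_leftTranslation (h : IsLocalMoufangLoop m U e) (x : V) :
    ∃ A : V →L[ℝ] V, HasFDerivAt (fun p => leftTranslation m e p x) A e ∧
      ∀ y, A y = mixedDerivative m e x y := by
  have h1 := ((h.contDiffAt_left e h.mem).hasFDerivAt_fderiv.comp e
    (hasFDerivAt_prodMk_right e e)).clm_apply (hasFDerivAt_const ((x, 0) : V × V) e)
  exact ⟨_, h1, fun y => by simp [mixedDerivative]⟩

theorem hasFDerivAt_rightTranslation (h : IsLocalMoufangLoop m U e) (x : V) :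
    ∃ A : V →L[ℝ] V, HasFDerivAt (fun p => rightTranslation m e p x) A e ∧
      ∀ y, A y = mixedDerivative m e y x := by
  have h1 := (HasFDerivAt.comp (f := fun p => (p, e)) e
    (h.contDiffAt_left e h.mem).hasFDerivAt_fderiv (hasFDerivAt_prodMk_left e e)).clm_apply
      (hasFDerivAt_const ((0, x) : V × V) e)
  exact ⟨_, h1, fun y => by
    simp [mixedDerivative, (h.contDiffAt_left e h.mem).fderiv_fderiv_symm (0, x)]⟩

theorem mixedDerivative_swap (h : IsLocalMoufangLoop m U e) (x y : V) :
    mixedDerivative (m ∘ Prod.swap) e x y = mixedDerivative m e y x := by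
  obtain ⟨A, hA, hA'⟩ := h.swap.hasFDerivAt_leftTranslation x
  obtain ⟨A', hB, hB'⟩ := h.hasFDerivAt_rightTranslation x
  simp only [leftTranslation_comp_swap] at hA
  rw [← hA', ← hB', hA.unique hB]

theorem hasFDerivAt_mul_mul (h : IsLocalMoufangLoop m U e) (hp : p ∈ U) :
    HasFDerivAt (fun g => m (m (g, p), g)) (leftTranslation m e p + rightTranslation m e p) e := by
  have h1 := (h.hasFDerivAt_mul_left hp).prodMk (hasFDerivAt_id e)
  have h2 := h.hasFDerivAt_right hp
  rw [← h.one_mul p hp] at h2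
  have h3 := HasFDerivAt.comp (f := fun g => (m (g, p), g)) e h2 h1
  refine h3.congr_fderiv ?_
  ext x
  simp [h.one_mul p hp, h.fderiv_right hp]

theorem hasFDerivAt_mul_mul' (h : IsLocalMoufangLoop m U e) (hp : p ∈ U) :
    HasFDerivAt (fun g => m (g, m (p, g))) (leftTranslation m e p + rightTranslation m e p) e := by
  have := h.swap.hasFDerivAt_mul_mul hp
  rwa [leftTranslation_comp_swap, rightTranslation_comp_swap, add_comm] at this

end IsLocalMoufangLoop
end LocalLoop

/-! ### Second-order consequences of the Moufang identities. -/

section LocalLoop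

open Filter Topology

variable {V : Type*} [NormedAddCommGroup V] [NormedSpace ℝ V]

namespace IsLocalMoufangLoop

variable {m : V × V → V} {U : Set V} {e p : V} {f : V → ℝ}

theorem contDiffAt_comp (h : IsLocalMoufangLoop m U e) (hf : ContDiffOn ℝ ∞ f U) (hp : p ∈ U) :
    ContDiffAt ℝ ∞ (fun z => f (m z)) (e, p) := by
  refine ContDiffAt.comp (e, p) ?_ (h.contDiffAt_left p hp)
  rw [h.one_mul p hp]
  exact hf.contDiffAt (h.mem_nhds hp)

theorem fderiv_comp_left (h : IsLocalMoufangLoop m U e) (hf : ContDiffOn ℝ ∞ f U) (hp : p ∈ U)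
    (y : V) :
    fderiv ℝ (fun z => f (m z)) (e, p) (y, 0) = fderiv ℝ f p (leftTranslation m e p y) := by
  have h1 : DifferentiableAt ℝ f (m (e, p)) := by
    rw [h.one_mul p hp]
    exact (hf.contDiffAt (h.mem_nhds hp)).differentiableAt (by simp)
  have := (h1.hasFDerivAt.comp (e, p) (h.hasFDerivAt_left hp)).fderiv
  rw [Function.comp_def] at this
  rw [this, h.one_mul p hp]
  rfl

/-- By symmetry of second derivatives, one may differentiate first in the left factor, which gives
the left translation applied to `f`, and then in the right one. -/
theorem fderiv_fderiv_comp (h : IsLocalMoufangLoop m U e) (hf : ContDiffOn ℝ ∞ f U) (hp : p ∈ U)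
    (v y : V) :
    fderiv ℝ (fderiv ℝ fun z => f (m z)) (e, p) (y, 0) (0, v) =
      fderiv ℝ (fun q => fderiv ℝ f q (leftTranslation m e q y)) p v := by
  have hH := h.contDiffAt_comp hf hp
  have h1 := (HasFDerivAt.comp (f := fun q => (e, q)) p hH.hasFDerivAt_fderiv
    (hasFDerivAt_prodMk_right e p)).clm_apply (hasFDerivAt_const ((y, 0) : V × V) p)
  have h2 := h1.congr_of_eventuallyEq (f₁ := fun q => fderiv ℝ f q (leftTranslation m e q y))
    (Filter.mem_of_superset (h.mem_nhds hp) fun q hq => (h.fderiv_comp_left hf hq y).symm)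
  rw [h2.fderiv, hH.fderiv_fderiv_symm]
  simp

theorem eventually_mem (h : IsLocalMoufangLoop m U e) : ∀ᶠ q in 𝓝 e, q ∈ U := h.mem_nhds h.mem

theorem eventually_mul_mem (h : IsLocalMoufangLoop m U e) (hp : p ∈ U) :
    ∀ᶠ q in 𝓝 e, m (q, p) ∈ U := by
  have := (h.hasFDerivAt_mul_left hp).continuousAt
  refine this.eventually (h.isOpen.mem_nhds ?_)
  show m (e, p) ∈ U
  rwa [h.one_mul p hp]

theorem eventually_differentiableAt_comp (h : IsLocalMoufangLoop m U e)
    (hf : ContDiffOn ℝ ∞ f U) (hp : p ∈ U) :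
    ∀ᶠ q in 𝓝 e, DifferentiableAt ℝ (fun z => f (m z)) (q, p) := by
  have h1 := ((h.contDiffAt_comp hf hp).of_le (m := 1) (by norm_cast)).eventually
    (by simp)
  have h2 : Tendsto (fun q : V => (q, p)) (𝓝 e) (𝓝 (e, p)) :=
    (continuous_id.prodMk continuous_const).continuousAt
  exact (h2.eventually h1).mono fun q hq => hq.differentiableAt one_ne_zero

theorem eventually_differentiableAt (h : IsLocalMoufangLoop m U e) (hp : p ∈ U) :
    ∀ᶠ q in 𝓝 e, DifferentiableAt ℝ m (q, p) := by
  have h1 := ((h.contDiffAt_left p hp).of_le (m := 1) (by norm_cast)).eventually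
    (by simp)
  have h2 : Tendsto (fun q : V => (q, p)) (𝓝 e) (𝓝 (e, p)) :=
    (continuous_id.prodMk continuous_const).continuousAt
  exact (h2.eventually h1).mono fun q hq => hq.differentiableAt one_ne_zero

theorem differentiableAt_of_contDiffOn (h : IsLocalMoufangLoop m U e)
    {W : Type*} [NormedAddCommGroup W] [NormedSpace ℝ W] {F : V → W} (hF : ContDiffOn ℝ ∞ F U)
    (hp : p ∈ U) : DifferentiableAt ℝ F p :=
  (hF.contDiffAt (h.mem_nhds hp)).differentiableAt (by simp)

/-- The derivative of `f` along the infinitesimal left translations is smooth. -/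
theorem contDiffOn_fderiv_apply (h : IsLocalMoufangLoop m U e) (hf : ContDiffOn ℝ ∞ f U)
    {X : V → V} (hX : ContDiffOn ℝ ∞ X U) : ContDiffOn ℝ ∞ (fun q => fderiv ℝ f q (X q)) U :=
  (hf.fderiv_of_isOpen h.isOpen (m := ∞) (by norm_cast)).clm_apply hX

theorem contDiffOn_leftTranslation_apply (h : IsLocalMoufangLoop m U e) (x : V) :
    ContDiffOn ℝ ∞ (fun q => leftTranslation m e q x) U :=
  h.contDiffOn_leftTranslation.clm_apply contDiffOn_const

theorem contDiffOn_rightTranslation_apply (h : IsLocalMoufangLoop m U e) (x : V) :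
    ContDiffOn ℝ ∞ (fun q => rightTranslation m e q x) U :=
  h.contDiffOn_rightTranslation.clm_apply contDiffOn_const

theorem hasFDerivAt_comp_mul (h : IsLocalMoufangLoop m U e) (hp : p ∈ U) {F : V → ℝ}
    (hF : ContDiffOn ℝ ∞ F U) (y : V) :
    ∃ A : V →L[ℝ] ℝ, HasFDerivAt (fun q => F (m (q, p))) A e ∧
      A y = fderiv ℝ F p (leftTranslation m e p y) := by
  have h1 : DifferentiableAt ℝ F (m (e, p)) := by
    rw [h.one_mul p hp]
    exact h.differentiableAt_of_contDiffOn hF hp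
  refine ⟨_, h1.hasFDerivAt.comp e (h.hasFDerivAt_mul_left hp), ?_⟩
  rw [h.one_mul p hp]
  rfl

/-- Differentiate `f((g(qp))g) = f((gq)(pg))` in `g` at the unit along `x`, which is `key`, and then
in `q` at the unit along `y`. The second derivative in the left factor alone is left unevaluated, to
be eliminated later. -/
theorem middle_derivative (h : IsLocalMoufangLoop m U e) (hf : ContDiffOn ℝ ∞ f U) (hp : p ∈ U)
    (x y : V) :
    fderiv ℝ (fun q => fderiv ℝ f q (leftTranslation m e q x) +
        fderiv ℝ f q (rightTranslation m e q x)) p (leftTranslation m e p y) =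
      fderiv ℝ (fderiv ℝ fun z => f (m z)) (e, p) (y, 0) (x, 0) +
        fderiv ℝ (fun q => fderiv ℝ f q (leftTranslation m e q y)) p (rightTranslation m e p x) +
        fderiv ℝ f p (leftTranslation m e p (mixedDerivative m e x y)) := by
  have key : ∀ᶠ q in 𝓝 e,
      fderiv ℝ f (m (q, p)) (leftTranslation m e (m (q, p)) x) +
        fderiv ℝ f (m (q, p)) (rightTranslation m e (m (q, p)) x) =
      fderiv ℝ (fun z => f (m z)) (q, p) (leftTranslation m e q x, rightTranslation m e p x) := by
    filter_upwards [h.eventually_mem, h.eventually_mul_mem hp,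
      h.eventually_differentiableAt_comp hf hp, (h.middle p hp).curry_nhds] with q hq hqp hd hm
    have d1 : DifferentiableAt ℝ f (m (m (e, m (q, p)), e)) := by
      rw [h.one_mul _ hqp, h.mul_one _ hqp]
      exact h.differentiableAt_of_contDiffOn hf hqp
    have h1 := d1.hasFDerivAt.comp e (h.hasFDerivAt_mul_mul hqp)
    rw [h.one_mul _ hqp, h.mul_one _ hqp] at h1
    have d2 : DifferentiableAt ℝ (fun z => f (m z)) (m (e, q), m (p, e)) := by
      rwa [h.one_mul _ hq, h.mul_one _ hp]
    have h2 := HasFDerivAt.comp (f := fun g => (m (g, q), m (p, g))) e d2.hasFDerivAt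
      ((h.hasFDerivAt_mul_left hq).prodMk (h.hasFDerivAt_mul_right hp))
    rw [h.one_mul _ hq, h.mul_one _ hp] at h2
    have h3 := h1.unique (h2.congr_of_eventuallyEq (hm.mono fun g hg => congrArg f hg))
    simpa using congrArg (fun A : V →L[ℝ] ℝ => A x) h3
  obtain ⟨A, hA, hAy⟩ := h.hasFDerivAt_comp_mul hp
    ((h.contDiffOn_fderiv_apply hf (h.contDiffOn_leftTranslation_apply x)).add
      (h.contDiffOn_fderiv_apply hf (h.contDiffOn_rightTranslation_apply x))) y
  obtain ⟨B, hB, hBy⟩ := h.hasFDerivAt_leftTranslation x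
  have hH := h.contDiffAt_comp hf hp
  have h4 := (HasFDerivAt.comp (f := fun q => (q, p)) e hH.hasFDerivAt_fderiv
    (hasFDerivAt_prodMk_left e p)).clm_apply
      (hB.prodMk (hasFDerivAt_const (rightTranslation m e p x) e))
  have h5 := congrArg (fun A : V →L[ℝ] ℝ => A y) (hA.unique (h4.congr_of_eventuallyEq key))
  simp only [hAy] at h5
  rw [h5]
  have split : ((x, rightTranslation m e p x) : V × V) =
      (x, 0) + (0, rightTranslation m e p x) := by
    simp
  simp only [add_apply, ContinuousLinearMap.comp_apply,
    ContinuousLinearMap.flip_apply, ContinuousLinearMap.prod_apply, ContinuousLinearMap.inl_apply,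
    Function.comp_apply, zero_apply, hBy, h.leftTranslation_one]
  rw [split, map_add, h.fderiv_fderiv_comp hf hp, h.fderiv_comp_left hf hp]
  ring

/-- The same two differentiations of `f(((qg)p)g) = f(q(g(pg)))` produce the same unevaluated second
derivative. -/
theorem right_derivative (h : IsLocalMoufangLoop m U e) (hf : ContDiffOn ℝ ∞ f U) (hp : p ∈ U)
    (x y : V) :
    fderiv ℝ (fderiv ℝ fun z => f (m z)) (e, p) (y, 0) (x, 0) +
        fderiv ℝ f p (leftTranslation m e p (mixedDerivative m e y x)) +
        fderiv ℝ (fun q => fderiv ℝ f q (rightTranslation m e q x)) p (leftTranslation m e p y) =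
      fderiv ℝ (fun q => fderiv ℝ f q (leftTranslation m e q y)) p
        (leftTranslation m e p x + rightTranslation m e p x) := by
  have key : ∀ᶠ q in 𝓝 e,
      fderiv ℝ f (m (q, p)) (rightTranslation m e (m (q, p)) x) =
      fderiv ℝ (fun z => f (m z)) (q, p)
        (-rightTranslation m e q x, leftTranslation m e p x + rightTranslation m e p x) := by
    filter_upwards [h.eventually_mem, h.eventually_mul_mem hp, h.eventually_differentiableAt hp,
      h.eventually_differentiableAt_comp hf hp, (h.right p hp).curry_nhds] with q hq hqp hd hd' hm
    have d0 : DifferentiableAt ℝ m (m (q, e), p) := by rwa [h.mul_one _ hq]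
    have h0 := HasFDerivAt.comp (f := fun g => (m (q, g), p)) e d0.hasFDerivAt
      ((h.hasFDerivAt_mul_right hq).prodMk (hasFDerivAt_const p e))
    rw [h.mul_one _ hq] at h0
    have d1 : HasFDerivAt m (fderiv ℝ m (m (q, p), e)) (m (m (q, e), p), e) := by
      rw [h.mul_one _ hq]
      exact h.hasFDerivAt_right hqp
    have h1 := HasFDerivAt.comp (f := fun g => (m (m (q, g), p), g)) e d1
      (h0.prodMk (hasFDerivAt_id e))
    have df : DifferentiableAt ℝ f (m (q, p)) := h.differentiableAt_of_contDiffOn hf hqp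
    have df' : HasFDerivAt f (fderiv ℝ f (m (q, p))) (m (m (m (q, e), p), e)) := by
      rw [h.mul_one _ hq, h.mul_one _ hqp]
      exact df.hasFDerivAt
    have h2 := HasFDerivAt.comp (f := fun g => m (m (m (q, g), p), g)) e df' h1
    have d3 : HasFDerivAt (fun z => f (m z)) (fderiv ℝ (fun z => f (m z)) (q, p))
        (q, m (e, m (p, e))) := by
      rw [h.mul_one _ hp, h.one_mul _ hp]
      exact hd'.hasFDerivAt
    have h3 := HasFDerivAt.comp (f := fun g => (q, m (g, m (p, g)))) e d3
      ((hasFDerivAt_const q e).prodMk (h.hasFDerivAt_mul_mul' hp))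
    have h4 := congrArg (fun A : V →L[ℝ] ℝ => A x)
      (h2.unique (h3.congr_of_eventuallyEq (hm.mono fun g hg => congrArg f hg)))
    have h5 : fderiv ℝ (fun z => f (m z)) (q, p) =
        (fderiv ℝ f (m (q, p))).comp (fderiv ℝ m (q, p)) :=
      (df.hasFDerivAt.comp (q, p) hd.hasFDerivAt).fderiv
    simp only [ContinuousLinearMap.comp_apply, ContinuousLinearMap.prod_apply,
      add_apply, zero_apply, ContinuousLinearMap.id_apply,
      h.fderiv_right hqp, map_add] at h4
    have split : ((-rightTranslation m e q x, leftTranslation m e p x + rightTranslation m e p x) :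
        V × V) = (0, leftTranslation m e p x + rightTranslation m e p x) -
          (rightTranslation m e q x, 0) := by simp
    rw [split, map_sub, ← h4, h5]
    simp
  obtain ⟨A, hA, hAy⟩ := h.hasFDerivAt_comp_mul hp
    (h.contDiffOn_fderiv_apply hf (h.contDiffOn_rightTranslation_apply x)) y
  obtain ⟨B, hB, hBy⟩ := h.hasFDerivAt_rightTranslation x
  have hH := h.contDiffAt_comp hf hp
  have h4 := (HasFDerivAt.comp (f := fun q => (q, p)) e hH.hasFDerivAt_fderiv
    (hasFDerivAt_prodMk_left e p)).clm_apply (hB.neg.prodMk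
      (hasFDerivAt_const (leftTranslation m e p x + rightTranslation m e p x) e))
  have h5 := congrArg (fun A : V →L[ℝ] ℝ => A y) (hA.unique (h4.congr_of_eventuallyEq key))
  simp only [hAy] at h5
  rw [h5]
  have split : ((-x, leftTranslation m e p x + rightTranslation m e p x) : V × V) =
      (0, leftTranslation m e p x + rightTranslation m e p x) - (x, 0) := by simp
  have split' : ((-mixedDerivative m e y x, 0) : V × V) = -(mixedDerivative m e y x, 0) := by simp
  simp only [add_apply, ContinuousLinearMap.comp_apply,
    ContinuousLinearMap.flip_apply, ContinuousLinearMap.prod_apply, ContinuousLinearMap.inl_apply,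
    Function.comp_apply, zero_apply, neg_apply, Pi.neg_apply, hBy,
    h.rightTranslation_one]
  rw [split, split', map_sub, map_neg, h.fderiv_fderiv_comp hf hp, h.fderiv_comp_left hf hp]
  ring

end IsLocalMoufangLoop
end LocalLoop

/-! ### The tangent algebra of a local Moufang loop -/

section TangentAlgebra

open Filter Topology

attribute [local instance] LieRing.ofAssociativeRing

theorem IsTranslationPair.comp {M M' L : Type*} [AddCommGroup M] [Module ℝ M] [AddCommGroup M']
    [Module ℝ M'] [LieRing L] [LieAlgebra ℝ L] {b : M →ₗ[ℝ] M →ₗ[ℝ] M}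
    {b' : M' →ₗ[ℝ] M' →ₗ[ℝ] M'} {S T : M' →ₗ[ℝ] L} (h : IsTranslationPair b' S T)
    (ι : M →ₗ[ℝ] M') (hι : ∀ x y, ι (b x y) = b' (ι x) (ι y)) :
    IsTranslationPair b (S ∘ₗ ι) (T ∘ₗ ι) where
  lie_left x y := by simp [hι, h.lie_left]
  lie_right x y := by simp [hι, h.lie_right]
  lie_swap x y := h.lie_swap _ _

/-- Here `q` is an uncontrolled but symmetric second derivative. Comparing `h1 x y` with `h2 y x`
removes `P`, `q` and `Z` together; comparing `h1` and `h2` at the same arguments removes `q` and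
leaves a commutator. -/
theorem antisymm_of_symmetric_relations {V W : Type*} [AddCommGroup W] [Module ℝ W]
    {P C q Z : V → V → W} (hq : ∀ x y, q x y = q y x)
    (h1 : ∀ x y, P x y + C x y = q x y + Z x y) (h2 : ∀ x y, P y x - C x y = q x y + Z y x)
    (x y : V) :
    C x y = -C y x ∧ P x y - P y x + (2 : ℝ) • C x y = Z x y - Z y x := by
  have e1 := h1 x y
  have e2 := h2 x y
  have e3 := h2 y x
  rw [hq y x] at e3
  constructor
  · linear_combination (norm := module) e1 - e3
  · linear_combination (norm := module) e1 - e2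

variable {V : Type*} [NormedAddCommGroup V] [NormedSpace ℝ V]

/-- The tangent product `[x, y]`, the antisymmetrized mixed second derivative of the
multiplication at the unit. -/
def tangentProduct (m : V × V → V) (e : V) : V →ₗ[ℝ] V →ₗ[ℝ] V :=
  LinearMap.mk₂ ℝ (fun x y => mixedDerivative m e x y - mixedDerivative m e y x)
    (fun x x' y => by
      have e1 : ((x + x', 0) : V × V) = (x, 0) + (x', 0) := by simp
      have e2 : ((0, x + x') : V × V) = (0, x) + (0, x') := by simp
      simp only [mixedDerivative, e1, e2, map_add, add_apply]
      abel)
    (fun a x y => by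
      have e1 : ((a • x, 0) : V × V) = a • (x, 0) := by simp
      have e2 : ((0, a • x) : V × V) = a • (0, x) := by simp
      simp only [mixedDerivative, e1, e2, map_smul, smul_apply, smul_sub])
    (fun x y y' => by
      have e1 : ((y + y', 0) : V × V) = (y, 0) + (y', 0) := by simp
      have e2 : ((0, y + y') : V × V) = (0, y) + (0, y') := by simp
      simp only [mixedDerivative, e1, e2, map_add, add_apply]
      abel)
    (fun a x y => by
      have e1 : ((a • y, 0) : V × V) = a • (y, 0) := by simp
      have e2 : ((0, a • y) : V × V) = a • (0, y) := by simp
      simp only [mixedDerivative, e1, e2, map_smul, smul_apply, smul_sub])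

theorem tangentProduct_apply (m : V × V → V) (e x y : V) :
    tangentProduct m e x y = mixedDerivative m e x y - mixedDerivative m e y x := rfl

theorem tangentProduct_antisymm (m : V × V → V) (e x y : V) :
    tangentProduct m e x y = -tangentProduct m e y x := by
  simp [tangentProduct_apply]

theorem IsLocalMoufangLoop.tangentProduct_swap {m : V × V → V} {U : Set V} {e : V}
    (h : IsLocalMoufangLoop m U e) (x y : V) :
    tangentProduct (m ∘ Prod.swap) e x y = -tangentProduct m e x y := by
  simp [tangentProduct_apply, h.mixedDerivative_swap]

/-- The smooth functions on an open set, extended by zero. -/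
def smoothFunctionsOn (U : Set V) : Submodule ℝ (V → ℝ) where
  carrier := {f | ContDiffOn ℝ ∞ f U ∧ ∀ x ∉ U, f x = 0}
  zero_mem' := ⟨contDiffOn_const, fun _ _ => rfl⟩
  add_mem' hf hg := ⟨hf.1.add hg.1, fun x hx => by simp [hf.2 x hx, hg.2 x hx]⟩
  smul_mem' a f hf := ⟨contDiffOn_const.smul hf.1, fun x hx => by simp [hf.2 x hx]⟩

/-- The type of smooth functions on an open set, extended by zero. -/
def SmoothFunctionOn (U : Set V) : Type _ := smoothFunctionsOn U

namespace SmoothFunctionOn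

variable {U : Set V}

instance : AddCommGroup (SmoothFunctionOn U) :=
  inferInstanceAs (AddCommGroup (smoothFunctionsOn U))

instance : Module ℝ (SmoothFunctionOn U) := inferInstanceAs (Module ℝ (smoothFunctionsOn U))

@[ext]
theorem ext {f g : SmoothFunctionOn U} (h : ∀ p ∈ U, f.1 p = g.1 p) : f = g := by
  refine Subtype.ext (funext fun p => ?_)
  by_cases hp : p ∈ U
  · exact h p hp
  · exact (f.2.2 p hp).trans (g.2.2 p hp).symm

theorem coe_add (f g : SmoothFunctionOn U) : (f + g).1 = f.1 + g.1 := rfl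

theorem coe_sub (f g : SmoothFunctionOn U) : (f - g).1 = f.1 - g.1 := rfl

theorem coe_smul (a : ℝ) (f : SmoothFunctionOn U) : (a • f).1 = a • f.1 := rfl

end SmoothFunctionOn

/-- Smoothness is asked on `U` only, so cutting off outside is harmless. The zero extension makes a
function determined by its values on `U`, and operator identities can be checked there. -/
theorem indicator_mem_smoothFunctionsOn {U : Set V} {f : V → ℝ} (hf : ContDiffOn ℝ ∞ f U) :
    U.indicator f ∈ smoothFunctionsOn U :=
  ⟨hf.congr fun _ hx => Set.indicator_of_mem hx f, fun _ hx => Set.indicator_of_notMem hx f⟩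

/-- The derivative of a smooth function along a smooth vector field. -/
def SmoothFunctionOn.derivative {U : Set V} (hU : IsOpen U) {Y : V → V} (hY : ContDiffOn ℝ ∞ Y U)
    (f : SmoothFunctionOn U) : SmoothFunctionOn U :=
  ⟨U.indicator fun p => fderiv ℝ f.1 p (Y p), indicator_mem_smoothFunctionsOn
    ((f.2.1.fderiv_of_isOpen hU (m := ∞) (by norm_cast)).clm_apply hY)⟩

theorem SmoothFunctionOn.derivative_apply {U : Set V} (hU : IsOpen U) {Y : V → V}
    (hY : ContDiffOn ℝ ∞ Y U) (f : SmoothFunctionOn U) {p : V} (hp : p ∈ U) :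
    (f.derivative hU hY).1 p = fderiv ℝ f.1 p (Y p) :=
  Set.indicator_of_mem hp fun p => fderiv ℝ f.1 p (Y p)

/-- The vector fields `p ↦ X p x` acting as derivations on smooth functions. -/
def fieldDerivation {U : Set V} (hU : IsOpen U) {X : V → V →L[ℝ] V} (hX : ContDiffOn ℝ ∞ X U) :
    V →ₗ[ℝ] Module.End ℝ (SmoothFunctionOn U) :=
  LinearMap.mk₂ ℝ
    (fun x f => f.derivative hU (hX.clm_apply (contDiffOn_const (c := x))))
    (fun x x' f => by
      ext p hp
      simp only [SmoothFunctionOn.coe_add, Pi.add_apply, SmoothFunctionOn.derivative_apply _ _ _ hp,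
        map_add])
    (fun a x f => by
      ext p hp
      simp only [SmoothFunctionOn.coe_smul, Pi.smul_apply,
        SmoothFunctionOn.derivative_apply _ _ _ hp, map_smul])
    (fun x f g => by
      ext p hp
      have hf := (f.2.1.contDiffAt (hU.mem_nhds hp)).differentiableAt (by simp)
      have hg := (g.2.1.contDiffAt (hU.mem_nhds hp)).differentiableAt (by simp)
      simp only [SmoothFunctionOn.coe_add, Pi.add_apply, SmoothFunctionOn.derivative_apply _ _ _ hp,
        fderiv_add hf hg, add_apply])
    (fun a x f => by
      ext p hp
      have hf := (f.2.1.contDiffAt (hU.mem_nhds hp)).differentiableAt (by simp)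
      simp only [SmoothFunctionOn.coe_smul, Pi.smul_apply,
        SmoothFunctionOn.derivative_apply _ _ _ hp, fderiv_const_smul hf, smul_apply])

theorem fieldDerivation_apply {U : Set V} (hU : IsOpen U) {X : V → V →L[ℝ] V}
    (hX : ContDiffOn ℝ ∞ X U) (x : V) (f : SmoothFunctionOn U) {p : V} (hp : p ∈ U) :
    (fieldDerivation hU hX x f).1 p = fderiv ℝ f.1 p (X p x) :=
  f.derivative_apply hU (hX.clm_apply contDiffOn_const) hp

theorem fieldDerivation_fieldDerivation_apply {U : Set V} (hU : IsOpen U) {X Y : V → V →L[ℝ] V}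
    (hX : ContDiffOn ℝ ∞ X U) (hY : ContDiffOn ℝ ∞ Y U) (x y : V) (f : SmoothFunctionOn U)
    {p : V} (hp : p ∈ U) :
    (fieldDerivation hU hX x (fieldDerivation hU hY y f)).1 p =
      fderiv ℝ (fun q => fderiv ℝ f.1 q (Y q y)) p (X p x) := by
  rw [fieldDerivation_apply hU hX x _ hp]
  have : (fieldDerivation hU hY y f).1 =ᶠ[𝓝 p] fun q => fderiv ℝ f.1 q (Y q y) :=
    Filter.mem_of_superset (hU.mem_nhds hp) fun q hq => fieldDerivation_apply hU hY y f hq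
  rw [this.fderiv_eq]

namespace IsLocalMoufangLoop

variable {m : V × V → V} {U : Set V} {e p : V}

/-- The infinitesimal left translations, as operators on smooth functions. -/
def leftOperator (h : IsLocalMoufangLoop m U e) :
    V →ₗ[ℝ] Module.End ℝ (SmoothFunctionOn U) :=
  fieldDerivation h.isOpen h.contDiffOn_leftTranslation

/-- The infinitesimal right translations, as operators on smooth functions. -/
def rightOperator (h : IsLocalMoufangLoop m U e) :
    V →ₗ[ℝ] Module.End ℝ (SmoothFunctionOn U) :=
  fieldDerivation h.isOpen h.contDiffOn_rightTranslation

theorem leftOperator_swap (h : IsLocalMoufangLoop m U e) :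
    h.swap.leftOperator = h.rightOperator := by
  have : ∀ {X Y : V → V →L[ℝ] V} (hX : ContDiffOn ℝ ∞ X U) (hY : ContDiffOn ℝ ∞ Y U), X = Y →
      fieldDerivation h.isOpen hX = fieldDerivation h.isOpen hY := by
    rintro X Y hX hY rfl
    rfl
  exact this _ _ (funext (leftTranslation_comp_swap m e))

theorem rightOperator_swap (h : IsLocalMoufangLoop m U e) :
    h.swap.rightOperator = h.leftOperator := by
  have : ∀ {X Y : V → V →L[ℝ] V} (hX : ContDiffOn ℝ ∞ X U) (hY : ContDiffOn ℝ ∞ Y U), X = Y →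
      fieldDerivation h.isOpen hX = fieldDerivation h.isOpen hY := by
    rintro X Y hX hY rfl
    rfl
  exact this _ _ (funext (rightTranslation_comp_swap m e))

theorem operator_relations (h : IsLocalMoufangLoop m U e) (x y : V) :
    ⁅h.leftOperator y, h.rightOperator x⁆ = -⁅h.leftOperator x, h.rightOperator y⁆ ∧
      ⁅h.leftOperator y, h.leftOperator x⁆ + (2 : ℝ) • ⁅h.leftOperator y, h.rightOperator x⁆ =
        h.leftOperator (tangentProduct m e x y) := by
  have key : ∀ f : SmoothFunctionOn U, ∀ p : V, p ∈ U → _ := fun f p hp =>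
    antisymm_of_symmetric_relations
      (P := fun x y => (h.leftOperator y (h.leftOperator x f)).1 p)
      (C := fun x y => (⁅h.leftOperator y, h.rightOperator x⁆ f).1 p)
      (q := fun x y => fderiv ℝ (fderiv ℝ fun z => f.1 (m z)) (e, p) (y, 0) (x, 0))
      (Z := fun x y => (h.leftOperator (mixedDerivative m e x y) f).1 p)
      (fun x y => (h.contDiffAt_comp f.2.1 hp).fderiv_fderiv_symm _ _)
      (fun x y => by
        have := h.middle_derivative f.2.1 hp x y
        rw [fderiv_fun_add (h.differentiableAt_of_contDiffOn (h.contDiffOn_fderiv_apply f.2.1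
          (h.contDiffOn_leftTranslation_apply x)) hp) (h.differentiableAt_of_contDiffOn
          (h.contDiffOn_fderiv_apply f.2.1 (h.contDiffOn_rightTranslation_apply x)) hp)] at this
        simp only [Ring.lie_def, LinearMap.sub_apply, Module.End.mul_apply,
          SmoothFunctionOn.coe_sub, Pi.sub_apply,
          leftOperator, rightOperator, fieldDerivation_fieldDerivation_apply _ _ _ _ _ f hp,
          fieldDerivation_apply _ _ _ f hp]
        rw [add_apply] at this
        linear_combination this)
      (fun x y => by
        have := h.right_derivative f.2.1 hp x y
        simp only [Ring.lie_def, LinearMap.sub_apply, Module.End.mul_apply,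
          SmoothFunctionOn.coe_sub, Pi.sub_apply,
          leftOperator, rightOperator, fieldDerivation_fieldDerivation_apply _ _ _ _ _ f hp,
          fieldDerivation_apply _ _ _ f hp]
        rw [map_add] at this
        linear_combination -this) x y
  constructor
  · exact LinearMap.ext fun f => SmoothFunctionOn.ext fun p hp => (key f p hp).1
  · refine LinearMap.ext fun f => SmoothFunctionOn.ext fun p hp => ?_
    rw [tangentProduct_apply, map_sub, Ring.lie_def (h.leftOperator y) (h.leftOperator x)]
    exact (key f p hp).2

/-- As derivations, the translations satisfy the relations for the opposite product; the minus signs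
correct this. `lie_right` is read off from the opposite loop. -/
theorem isTranslationPair (h : IsLocalMoufangLoop m U e) :
    IsTranslationPair (tangentProduct m e) (-h.leftOperator) (-h.rightOperator) where
  lie_left x y := by
    obtain ⟨h1, h2⟩ := h.operator_relations x y
    rw [h1, ← lie_skew] at h2
    simp only [LinearMap.neg_apply, neg_lie, lie_neg, neg_neg, ← h2]
    module
  lie_right x y := by
    obtain ⟨h1, h2⟩ := h.swap.operator_relations x y
    rw [h.leftOperator_swap, h.rightOperator_swap] at h2
    rw [h.tangentProduct_swap, map_neg, ← lie_skew, ← lie_skew (h.rightOperator y)] at h2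
    simp only [LinearMap.neg_apply, neg_lie, lie_neg, neg_neg]
    linear_combination (norm := module) -h2
  lie_swap x y := by
    obtain ⟨h1, h2⟩ := h.operator_relations x y
    rw [← lie_skew] at h1
    simp only [LinearMap.neg_apply, neg_lie, lie_neg, neg_neg]
    exact (neg_inj.mp h1).symm

/-- At the unit the left translation field takes the value `x`, and continuous linear functionals,
used as test functions, separate vectors. -/
theorem leftOperator_injective (h : IsLocalMoufangLoop m U e) :
    Function.Injective h.leftOperator := by
  refine (injective_iff_map_eq_zero _).2 fun x hx => ?_
  refine SeparatingDual.eq_zero_of_forall_dual_eq_zero (R := ℝ) fun g => ?_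
  let F : SmoothFunctionOn U :=
    ⟨U.indicator g, indicator_mem_smoothFunctionsOn g.contDiff.contDiffOn⟩
  have h1 : fderiv ℝ F.1 e (leftTranslation m e e x) = 0 := by
    rw [← fieldDerivation_apply h.isOpen h.contDiffOn_leftTranslation x F h.mem]
    exact congrArg (fun A : Module.End ℝ (SmoothFunctionOn U) => (A F).1 e) hx
  have h2 : F.1 =ᶠ[𝓝 e] g :=
    Filter.mem_of_superset (h.mem_nhds h.mem) fun q hq => Set.indicator_of_mem hq _
  rwa [h2.fderiv_eq, h.leftTranslation_one, ContinuousLinearMap.fderiv] at h1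

/-- The tangent algebra of a local Moufang loop is a Mal'tsev algebra. -/
theorem isMaltsevBracket_tangentProduct (h : IsLocalMoufangLoop m U e) :
    IsMaltsevBracket fun x y => tangentProduct m e x y :=
  h.isTranslationPair.isMaltsevBracket (tangentProduct_antisymm m e)
    fun _ _ hxy => h.leftOperator_injective (neg_injective hxy)

end IsLocalMoufangLoop
end TangentAlgebra

/-! ### Generators of local birepresentations -/

section LocalBirepresentation

open Filter Topology

attribute [local instance] LieRing.ofAssociativeRing

variable {V : Type*} [NormedAddCommGroup V] [NormedSpace ℝ V]
  {A : Type*} [NormedRing A] [NormedAlgebra ℝ A]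

/-- A differentiable birepresentation of a local Moufang loop in a normed algebra. -/
structure IsLocalBirepresentation (m : V × V → V) (e : V) (S T : V → A) : Prop where
  left_one : S e = 1
  right_one : T e = 1
  left_differentiable : ∀ᶠ q in 𝓝 e, DifferentiableAt ℝ S q
  right_differentiable : ∀ᶠ q in 𝓝 e, DifferentiableAt ℝ T q
  left_mul : ∀ᶠ z : V × V in 𝓝 (e, e), T z.2 * S z.2 * S z.1 = S (m (z.2, z.1)) * T z.2
  left_mul' : ∀ᶠ z : V × V in 𝓝 (e, e), T z.2 * S (m (z.1, z.2)) = S z.1 * (T z.2 * S z.2)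
  right_mul : ∀ᶠ z : V × V in 𝓝 (e, e), S z.2 * T z.2 * T z.1 = T (m (z.1, z.2)) * S z.2
  right_mul' : ∀ᶠ z : V × V in 𝓝 (e, e), S z.2 * T (m (z.2, z.1)) = T z.1 * (S z.2 * T z.2)

namespace IsLocalBirepresentation

variable {m : V × V → V} {U : Set V} {e : V} {S T : V → A}

theorem swap (hST : IsLocalBirepresentation m e S T) :
    IsLocalBirepresentation (m ∘ Prod.swap) e T S where
  left_one := hST.right_one
  right_one := hST.left_one
  left_differentiable := hST.right_differentiable
  right_differentiable := hST.left_differentiable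
  left_mul := hST.right_mul
  left_mul' := hST.right_mul'
  right_mul := hST.left_mul
  right_mul' := hST.left_mul'

/-- Differentiate the birepresentation relation at `(g, q)` with respect to `g` at the unit. -/
theorem eventually_left_equation (hST : IsLocalBirepresentation m e S T)
    (h : IsLocalMoufangLoop m U e) :
    ∀ᶠ q in 𝓝 e, ∀ x, fderiv ℝ S q (leftTranslation m e q x) =
      (fderiv ℝ T e x + fderiv ℝ S e x) * S q - S q * fderiv ℝ T e x := by
  have hS := hST.left_differentiable.self_of_nhds.hasFDerivAt
  have hT := hST.right_differentiable.self_of_nhds.hasFDerivAt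
  filter_upwards [h.eventually_mem, hST.left_differentiable, hST.left_mul.curry_nhds]
    with q hq hd hm x
  have h1 := (hT.mul' hS).mul_const' (S q)
  have d1 : HasFDerivAt S (fderiv ℝ S q) (m (e, q)) := by
    rw [h.one_mul q hq]
    exact hd.hasFDerivAt
  have h2 := (d1.comp e (h.hasFDerivAt_mul_left hq)).mul' hT
  have h3 := congrArg (fun B : V →L[ℝ] A => B x) (h1.unique (h2.congr_of_eventuallyEq hm))
  simp [hST.left_one, hST.right_one, h.one_mul q hq] at h3
  linear_combination (norm := noncomm_ring) -h3

theorem eventually_right_equation (hST : IsLocalBirepresentation m e S T)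
    (h : IsLocalMoufangLoop m U e) :
    ∀ᶠ q in 𝓝 e, ∀ x, fderiv ℝ S q (rightTranslation m e q x) =
      S q * (fderiv ℝ T e x + fderiv ℝ S e x) - fderiv ℝ T e x * S q := by
  have hS := hST.left_differentiable.self_of_nhds.hasFDerivAt
  have hT := hST.right_differentiable.self_of_nhds.hasFDerivAt
  filter_upwards [h.eventually_mem, hST.left_differentiable, hST.left_mul'.curry_nhds]
    with q hq hd hm x
  have h1 := (hT.mul' hS).const_mul (S q)
  have d1 : HasFDerivAt S (fderiv ℝ S q) (m (q, e)) := by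
    rw [h.mul_one q hq]
    exact hd.hasFDerivAt
  have h2 := hT.mul' (d1.comp e (h.hasFDerivAt_mul_right hq))
  have h3 := congrArg (fun B : V →L[ℝ] A => B x)
    (h1.unique (h2.congr_of_eventuallyEq (hm.mono fun _ hg => hg.symm)))
  simp [hST.left_one, hST.right_one, h.mul_one q hq] at h3
  linear_combination (norm := noncomm_ring) -h3

/-- A bootstrap: near `e` the left translation is invertible and depends smoothly on the point, so
the first-order equation expresses `fderiv ℝ S` through `S` itself. -/
theorem differentiableAt_fderiv [CompleteSpace V] (hST : IsLocalBirepresentation m e S T)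
    (h : IsLocalMoufangLoop m U e) : DifferentiableAt ℝ (fderiv ℝ S) e := by
  have hS := hST.left_differentiable.self_of_nhds
  have hL : DifferentiableAt ℝ (leftTranslation m e) e :=
    h.differentiableAt_of_contDiffOn h.contDiffOn_leftTranslation h.mem
  have hL1 : leftTranslation m e e = 1 := by
    ext x
    exact h.leftTranslation_one x
  let Ψ : V → V →L[ℝ] A := fun q =>
    ((ContinuousLinearMap.mul ℝ A).flip (S q)).comp (fderiv ℝ T e + fderiv ℝ S e) -
      (ContinuousLinearMap.mul ℝ A (S q)).comp (fderiv ℝ T e)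
  have hΨ : DifferentiableAt ℝ Ψ e := by
    refine DifferentiableAt.sub (DifferentiableAt.clm_comp ?_ (differentiableAt_const _))
      (DifferentiableAt.clm_comp ?_ (differentiableAt_const _))
    · exact (ContinuousLinearMap.mul ℝ A).flip.differentiableAt.comp e hS
    · exact (ContinuousLinearMap.mul ℝ A).differentiableAt.comp e hS
  have hunit : ∀ᶠ q in 𝓝 e, IsUnit (leftTranslation m e q) := by
    refine hL.continuousAt.eventually (Units.isOpen.mem_nhds ?_)
    rw [hL1]
    exact isUnit_one
  have hinv : DifferentiableAt ℝ (fun q => Ring.inverse (leftTranslation m e q)) e := by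
    refine DifferentiableAt.comp e (g := Ring.inverse) ?_ hL
    rw [hL1]
    exact differentiableAt_inverse isUnit_one
  refine (hΨ.clm_comp hinv).congr_of_eventuallyEq ?_
  filter_upwards [hunit, hST.eventually_left_equation h] with q hq hq'
  have h1 : (fderiv ℝ S q).comp (leftTranslation m e q) = Ψ q := by
    ext x
    exact hq' x
  rw [← h1, ContinuousLinearMap.comp_assoc]
  change _ = (fderiv ℝ S q).comp (leftTranslation m e q * Ring.inverse (leftTranslation m e q))
  rw [Ring.mul_inverse_cancel _ hq]
  rfl

/-- Differentiate the left and right first-order equations once more at `e`. The second derivative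
of `S`, symmetric because `S` is differentiable near `e`, is the unknown to be eliminated. -/
theorem generator_relations [CompleteSpace V] (hST : IsLocalBirepresentation m e S T)
    (h : IsLocalMoufangLoop m U e) (x y : V) :
    ⁅fderiv ℝ T e x, fderiv ℝ S e y⁆ = -⁅fderiv ℝ T e y, fderiv ℝ S e x⁆ ∧
      ⁅fderiv ℝ S e x, fderiv ℝ S e y⁆ + (2 : ℝ) • ⁅fderiv ℝ T e x, fderiv ℝ S e y⁆ =
        fderiv ℝ S e (tangentProduct m e x y) := by
  have hS := hST.left_differentiable.self_of_nhds.hasFDerivAt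
  have hS2 := (hST.differentiableAt_fderiv h).hasFDerivAt
  have key := antisymm_of_symmetric_relations
    (P := fun x y => fderiv ℝ S e x * fderiv ℝ S e y)
    (C := fun x y => ⁅fderiv ℝ T e x, fderiv ℝ S e y⁆)
    (q := fun x y => fderiv ℝ (fderiv ℝ S) e y x)
    (Z := fun x y => fderiv ℝ S e (mixedDerivative m e x y))
    (fun x y => second_derivative_symmetric_of_eventually
      (hST.left_differentiable.mono fun q hq => hq.hasFDerivAt) hS2 _ _)
    (fun x y => by
      obtain ⟨B, hB, hBy⟩ := h.hasFDerivAt_leftTranslation x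
      have h1 := hS2.clm_apply hB
      have h2 := (hS.const_mul (fderiv ℝ T e x + fderiv ℝ S e x)).sub
        (hS.mul_const' (fderiv ℝ T e x))
      have h3 := congrArg (fun B : V →L[ℝ] A => B y) (h1.unique (h2.congr_of_eventuallyEq
        ((hST.eventually_left_equation h).mono fun q hq => hq x)))
      simp [hBy, h.leftTranslation_one] at h3
      rw [Ring.lie_def]
      linear_combination (norm := noncomm_ring) -h3)
    (fun x y => by
      obtain ⟨B, hB, hBy⟩ := h.hasFDerivAt_rightTranslation x
      have h1 := hS2.clm_apply hB
      have h2 := (hS.mul_const' (fderiv ℝ T e x + fderiv ℝ S e x)).sub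
        (hS.const_mul (fderiv ℝ T e x))
      have h3 := congrArg (fun B : V →L[ℝ] A => B y) (h1.unique (h2.congr_of_eventuallyEq
        ((hST.eventually_right_equation h).mono fun q hq => hq x)))
      simp [hBy, h.rightTranslation_one] at h3
      rw [Ring.lie_def]
      linear_combination (norm := noncomm_ring) -h3) x y
  rw [tangentProduct_apply, map_sub, Ring.lie_def (fderiv ℝ S e x) (fderiv ℝ S e y)]
  exact key

/-- The generators of a local birepresentation satisfy the translation relations. -/
theorem isTranslationPair [CompleteSpace V] (hST : IsLocalBirepresentation m e S T)
    (h : IsLocalMoufangLoop m U e) :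
    IsTranslationPair (tangentProduct m e) (fderiv ℝ S e : V →ₗ[ℝ] A)
      (fderiv ℝ T e : V →ₗ[ℝ] A) where
  lie_left x y := by
    obtain ⟨h1, h2⟩ := hST.generator_relations h x y
    rw [h1, lie_skew] at h2
    simp only [ContinuousLinearMap.coe_coe, ← h2]
    module
  lie_right x y := by
    obtain ⟨h1, h2⟩ := hST.swap.generator_relations h.swap x y
    rw [h.tangentProduct_swap, map_neg] at h2
    simp only [ContinuousLinearMap.coe_coe, ← h2]
    module
  lie_swap x y := by
    obtain ⟨h1, h2⟩ := hST.generator_relations h x y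
    rw [lie_skew] at h1
    exact h1.symm

end IsLocalBirepresentation
end LocalBirepresentation

/-! ### The commutator of a local Moufang loop -/

section Commutator

open Filter Topology

variable {V : Type*} [NormedAddCommGroup V] [NormedSpace ℝ V]

/-- The mixed second derivative of the commutator `q`, determined by `(q(g,h) h) g = g h`, is the
tangent product. -/
theorem IsLocalMoufangLoop.hasFDerivAt_commutator {m : V × V → V} {U : Set V} {e : V}
    (h : IsLocalMoufangLoop m U e) {q : V × V → V} (hq : ContDiffAt ℝ ∞ q (e, e))
    (hq1 : ∀ᶠ x in 𝓝 e, q (x, e) = e)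
    (hqm : ∀ᶠ z : V × V in 𝓝 (e, e), m (m (q z, z.2), z.1) = m z) (y : V) :
    ∃ A : V →L[ℝ] V, HasFDerivAt (fun x => fderiv ℝ q (x, e) (0, y)) A e ∧
      ∀ x, A x = tangentProduct m e x y := by
  have hdiff : ∀ᶠ x in 𝓝 e, DifferentiableAt ℝ q (x, e) := by
    have h1 := (hq.of_le (m := 1) (by norm_cast)).eventually (by simp)
    have h2 : Tendsto (fun x : V => (x, e)) (𝓝 e) (𝓝 (e, e)) :=
      (continuous_id.prodMk continuous_const).continuousAt
    exact (h2.eventually h1).mono fun x hx => hx.differentiableAt one_ne_zero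
  -- The derivative of `(q(x, h) h) x = x h` in `h` at the unit, using `q(x, e) = e`.
  have key : ∀ᶠ x in 𝓝 e,
      leftTranslation m e x (fderiv ℝ q (x, e) (0, y) + y) = rightTranslation m e x y := by
    filter_upwards [h.eventually_mem, hdiff, hq1, hqm.curry_nhds] with x hx hd hx1 hm
    have h1 : HasFDerivAt (fun g => q (x, g))
        ((fderiv ℝ q (x, e)).comp (ContinuousLinearMap.inr ℝ V V)) e :=
      HasFDerivAt.comp e hd.hasFDerivAt (hasFDerivAt_prodMk_right x e)
    have d2 : HasFDerivAt m (fderiv ℝ m (e, e)) (q (x, e), e) := by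
      rw [hx1]
      exact h.hasFDerivAt_left h.mem
    have h2 := HasFDerivAt.comp (f := fun g => (q (x, g), g)) e d2 (h1.prodMk (hasFDerivAt_id e))
    have d3 : HasFDerivAt (fun g => m (g, x)) (leftTranslation m e x) (m (q (x, e), e)) := by
      rw [hx1, h.one_mul e h.mem]
      exact h.hasFDerivAt_mul_left hx
    have h3 := HasFDerivAt.comp (f := fun g => m (q (x, g), g)) e d3 h2
    have h4 := (h.hasFDerivAt_mul_right hx).unique
      (h3.congr_of_eventuallyEq (hm.mono fun g hg => hg.symm))
    have h5 := congrArg (fun A : V →L[ℝ] V => A y) h4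
    simp only [ContinuousLinearMap.comp_apply, ContinuousLinearMap.prod_apply,
      ContinuousLinearMap.inr_apply, ContinuousLinearMap.id_apply, h.fderiv_left h.mem,
      h.leftTranslation_one] at h5
    exact h5.symm
  have hW := (HasFDerivAt.comp (f := fun x => (x, e)) e hq.hasFDerivAt_fderiv
    (hasFDerivAt_prodMk_left e e)).clm_apply (hasFDerivAt_const ((0, y) : V × V) e)
  have hL := (h.differentiableAt_of_contDiffOn h.contDiffOn_leftTranslation h.mem).hasFDerivAt
  obtain ⟨A, hA, hA'⟩ := h.hasFDerivAt_leftTranslation y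
  obtain ⟨B, hB, hB'⟩ := h.hasFDerivAt_rightTranslation y
  refine ⟨_, hW, fun x => ?_⟩
  -- Hence differentiating the left translation in `key` contributes only `mixedDerivative m e y x`.
  have hW0 : fderiv ℝ q (e, e) (0, y) = 0 := by
    have := key.self_of_nhds
    rw [h.leftTranslation_one, h.rightTranslation_one] at this
    simpa using this
  have h6 := congrArg (fun A : V →L[ℝ] V => A x)
    (hB.unique ((hL.clm_apply (hW.add_const y)).congr_of_eventuallyEq
      (key.mono fun x hx => hx.symm)))
  have h7 := congrArg (fun A : V →L[ℝ] V => A x) (hA.unique (hL.clm_apply (hasFDerivAt_const y e)))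
  simp [hA'] at h7
  simp [hB', hW0, h.leftTranslation_one, ← h7] at h6
  rw [tangentProduct_apply, h6]
  simp

end Commutator

theorem hasDerivAt_add_single {r : ℕ} (x : EuclideanSpace ℝ (Fin r)) (l : Fin r) :
    HasDerivAt (fun s : ℝ => x + EuclideanSpace.single l s) (EuclideanSpace.single l 1) 0 := by
  have h1 : (fun s : ℝ => x + EuclideanSpace.single l s) =
      fun s => x + s • EuclideanSpace.single l (1 : ℝ) := by
    funext s
    ext i
    by_cases hi : i = l <;> simp [hi]
  rw [h1]
  simpa using ((hasDerivAt_id (0 : ℝ)).smul_const (EuclideanSpace.single l (1 : ℝ))).const_add x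

/-! ### Local coordinates on an analytic Moufang loop -/

section Chart

open Filter Topology

variable {r : ℕ} {G : Type*} [TopologicalSpace G]

/-- The multiplication in the coordinates given by a chart. -/
def chartMul [MoufangLoop G] (φ : OpenPartialHomeomorph G (EuclideanSpace ℝ (Fin r)))
    (z : EuclideanSpace ℝ (Fin r) × EuclideanSpace ℝ (Fin r)) : EuclideanSpace ℝ (Fin r) :=
  φ (φ.symm z.1 * φ.symm z.2)

theorem symm_chartMul [MoufangLoop G] {φ : OpenPartialHomeomorph G (EuclideanSpace ℝ (Fin r))}
    {x y : EuclideanSpace ℝ (Fin r)} (h : φ.symm x * φ.symm y ∈ φ.source) :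
    φ.symm (chartMul φ (x, y)) = φ.symm x * φ.symm y := φ.left_inv h

theorem ContinuousAt.moufang_mul (r : ℕ) {G : Type*} [TopologicalSpace G]
    [ChartedSpace (EuclideanSpace ℝ (Fin r)) G] [MoufangLoop G] [IsAnalyticMoufangLoop r G]
    {X : Type*} [TopologicalSpace X] {a b : X → G} {x : X}
    (ha : ContinuousAt a x) (hb : ContinuousAt b x) : ContinuousAt (fun x => a x * b x) x :=
  ContinuousAt.comp (g := fun q : G × G => q.1 * q.2)
    (IsAnalyticMoufangLoop.contMDiff_mul' (r := r) (G := G)).continuous.continuousAt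
    (ha.prodMk hb)

variable [ChartedSpace (EuclideanSpace ℝ (Fin r)) G]
  {φ : OpenPartialHomeomorph G (EuclideanSpace ℝ (Fin r))}

variable {E : Type*} [NormedAddCommGroup E] [NormedSpace ℝ E]

theorem contMDiffAt_chart_symm_comp (hφ : φ ∈ IsManifold.maximalAtlas (𝓡 r) ω G)
    {a : E → EuclideanSpace ℝ (Fin r)} {x : E} (ha : ContDiffAt ℝ ω a x) (hx : a x ∈ φ.target) :
    ContMDiffAt 𝓘(ℝ, E) (𝓡 r) ω (fun x => φ.symm (a x)) x :=
  ContMDiffAt.comp x (((contMDiffOn_symm_of_mem_maximalAtlas hφ).contMDiffAt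
    (φ.open_target.mem_nhds hx))) ha.contMDiffAt

theorem contDiffAt_chart_comp (hφ : φ ∈ IsManifold.maximalAtlas (𝓡 r) ω G) {a : E → G} {x : E}
    (ha : ContMDiffAt 𝓘(ℝ, E) (𝓡 r) ω a x) (hx : a x ∈ φ.source) :
    ContDiffAt ℝ ∞ (fun x => φ (a x)) x := by
  have : ContMDiffAt 𝓘(ℝ, E) (𝓡 r) ω (fun x => φ (a x)) x :=
    ContMDiffAt.comp x ((contMDiffOn_of_mem_maximalAtlas hφ).contMDiffAt
      (φ.open_source.mem_nhds hx)) ha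
  exact (contMDiffAt_iff_contDiffAt.1 this).of_le le_top

variable [MoufangLoop G] [IsAnalyticMoufangLoop r G]

theorem ContMDiffAt.moufang_mul {a b : E → G} {x : E}
    (ha : ContMDiffAt 𝓘(ℝ, E) (𝓡 r) ω a x) (hb : ContMDiffAt 𝓘(ℝ, E) (𝓡 r) ω b x) :
    ContMDiffAt 𝓘(ℝ, E) (𝓡 r) ω (fun x => a x * b x) x :=
  ContMDiffAt.comp x (g := fun q : G × G => q.1 * q.2)
    (IsAnalyticMoufangLoop.contMDiff_mul' (r := r) (G := G)).contMDiffAt (ha.prodMk hb)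

theorem ContMDiffAt.moufang_inv {a : E → G} {x : E}
    (ha : ContMDiffAt 𝓘(ℝ, E) (𝓡 r) ω a x) :
    ContMDiffAt 𝓘(ℝ, E) (𝓡 r) ω (fun x => (a x)⁻¹) x :=
  ContMDiffAt.comp x (g := fun q : G => q⁻¹)
    (IsAnalyticMoufangLoop.contMDiff_inv' (r := r) (G := G)).contMDiffAt ha

theorem contDiffAt_chartMul (hφ : φ ∈ IsManifold.maximalAtlas (𝓡 r) ω G)
    {x y : EuclideanSpace ℝ (Fin r)} (hx : x ∈ φ.target) (hy : y ∈ φ.target)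
    (hxy : φ.symm x * φ.symm y ∈ φ.source) : ContDiffAt ℝ ∞ (chartMul φ) (x, y) :=
  contDiffAt_chart_comp hφ (ContMDiffAt.moufang_mul
    (contMDiffAt_chart_symm_comp hφ contDiffAt_fst hx)
    (contMDiffAt_chart_symm_comp hφ contDiffAt_snd hy)) hxy

/-- With two variables at the unit every partial product is `φ.symm p` or `1`, so by continuity all
partial products stay in the chart domain nearby and the global identities carry over. -/
theorem isLocalMoufangLoop_chartMul (hφ : φ ∈ IsManifold.maximalAtlas (𝓡 r) ω G)
    (hφ1 : (1 : G) ∈ φ.source) : IsLocalMoufangLoop (chartMul φ) φ.target (φ 1) := by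
  have h1 : φ.symm (φ 1) = 1 := φ.left_inv hφ1
  have he : φ 1 ∈ φ.target := φ.map_source hφ1
  have hsymm : ContinuousAt φ.symm (φ 1) := φ.symm.continuousAt he
  have ha : ContinuousAt (fun z : EuclideanSpace ℝ (Fin r) × EuclideanSpace ℝ (Fin r) =>
    φ.symm z.1) (φ 1, φ 1) := ContinuousAt.comp (g := φ.symm) hsymm continuousAt_fst
  have hb : ContinuousAt (fun z : EuclideanSpace ℝ (Fin r) × EuclideanSpace ℝ (Fin r) =>
    φ.symm z.2) (φ 1, φ 1) := ContinuousAt.comp (g := φ.symm) hsymm continuousAt_snd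
  have hc : ∀ P : G, ContinuousAt
      (fun _ : EuclideanSpace ℝ (Fin r) × EuclideanSpace ℝ (Fin r) => P) (φ 1, φ 1) :=
    fun P => continuousAt_const
  have ev : ∀ {F : EuclideanSpace ℝ (Fin r) × EuclideanSpace ℝ (Fin r) → G},
      ContinuousAt F (φ 1, φ 1) → F (φ 1, φ 1) ∈ φ.source →
      ∀ᶠ z in 𝓝 (φ 1, φ 1), F z ∈ φ.source := fun hF hm =>
    hF.eventually (φ.open_source.mem_nhds hm)
  have one_mul := MoufangLoop.one_mul' (G := G)
  have mul_one := MoufangLoop.mul_one' (G := G)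
  refine ⟨φ.open_target, he, fun p hp => ?_, fun p hp => ?_, fun p hp => ?_, fun p hp => ?_,
    fun p hp => ?_, fun p hp => ?_, fun p hp => ?_, fun p hp => ?_⟩
  · exact contDiffAt_chartMul hφ he hp (by simpa only [h1, one_mul] using φ.map_target hp)
  · exact contDiffAt_chartMul hφ hp he (by simpa only [h1, mul_one] using φ.map_target hp)
  · simp only [chartMul, h1, one_mul, φ.right_inv hp]
  · simp only [chartMul, h1, mul_one, φ.right_inv hp]
  all_goals have hP : φ.symm p ∈ φ.source := φ.map_target hp
  · filter_upwards [ev (ha.moufang_mul r (hc (φ.symm p))) (by simpa only [h1, one_mul]),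
      ev (hb.moufang_mul r (ha.moufang_mul r (hc (φ.symm p))))
        (by simpa only [h1, one_mul]),
      ev (hb.moufang_mul r ha) (by simpa only [h1, one_mul]),
      ev ((hc (φ.symm p)).moufang_mul r hb) (by simpa only [h1, mul_one])]
      with z hz1 hz2 hz3 hz4
    simp only [chartMul, φ.left_inv hz1, φ.left_inv hz2, φ.left_inv hz3, φ.left_inv hz4,
      MoufangLoop.moufang']
  · filter_upwards [ev ((hc (φ.symm p)).moufang_mul r ha) (by simpa only [h1, mul_one]),
      ev (((hc (φ.symm p)).moufang_mul r ha).moufang_mul r hb)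
        (by simpa only [h1, mul_one]),
      ev (hb.moufang_mul r (hc (φ.symm p))) (by simpa only [h1, one_mul]),
      ev (ha.moufang_mul r hb) (by simpa only [h1, mul_one])]
      with z hz1 hz2 hz3 hz4
    simp only [chartMul, φ.left_inv hz1, φ.left_inv hz2, φ.left_inv hz3, φ.left_inv hz4,
      MoufangLoop.moufang', MoufangLoop.flexible]
  · filter_upwards [ev (ha.moufang_mul r hb) (by simpa only [h1, mul_one]),
      ev ((ha.moufang_mul r hb).moufang_mul r (hc (φ.symm p)))
        (by simpa only [h1, mul_one, one_mul]),
      ev ((hc (φ.symm p)).moufang_mul r hb) (by simpa only [h1, mul_one]),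
      ev (hb.moufang_mul r ((hc (φ.symm p)).moufang_mul r hb))
        (by simpa only [h1, mul_one, one_mul])]
      with z hz1 hz2 hz3 hz4
    simp only [chartMul, φ.left_inv hz1, φ.left_inv hz2, φ.left_inv hz3, φ.left_inv hz4,
      MoufangLoop.right_moufang]
  · filter_upwards [ev (hb.moufang_mul r ha) (by simpa only [h1, mul_one]),
      ev ((hc (φ.symm p)).moufang_mul r (hb.moufang_mul r ha))
        (by simpa only [h1, mul_one, one_mul]),
      ev (hb.moufang_mul r (hc (φ.symm p))) (by simpa only [h1, one_mul]),
      ev ((hb.moufang_mul r (hc (φ.symm p))).moufang_mul r hb)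
        (by simpa only [h1, mul_one, one_mul])]
      with z hz1 hz2 hz3 hz4
    simp only [chartMul, φ.left_inv hz1, φ.left_inv hz2, φ.left_inv hz3, φ.left_inv hz4,
      MoufangLoop.left_moufang]

/-- Without associativity, the right inverse property still gives `(q h) g = g h` for the commutator
`q`, as `hasFDerivAt_commutator` requires. -/
theorem structureConstant_eq_tangentProduct (hφ : φ ∈ IsManifold.maximalAtlas (𝓡 r) ω G)
    (hφ1 : (1 : G) ∈ φ.source) (i j k : Fin r) :
    structureConstant φ i j k = tangentProduct (chartMul φ) (φ 1)
      (EuclideanSpace.single j 1) (EuclideanSpace.single k 1) i := by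
  have h := isLocalMoufangLoop_chartMul hφ hφ1
  have h1 : φ.symm (φ 1) = 1 := φ.left_inv hφ1
  have he : φ 1 ∈ φ.target := φ.map_source hφ1
  let F : EuclideanSpace ℝ (Fin r) × EuclideanSpace ℝ (Fin r) → G := fun z =>
    φ.symm z.1 * φ.symm z.2 * (φ.symm z.1)⁻¹ * (φ.symm z.2)⁻¹
  have inv_one : (1 : G)⁻¹ = 1 := by
    rw [← MoufangLoop.one_mul' (1 : G)⁻¹, MoufangLoop.mul_inv']
  have hF1 : ∀ x, F (x, φ 1) = 1 := fun x => by
    simp only [F, h1, inv_one, MoufangLoop.mul_one', MoufangLoop.mul_inv']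
  have ha := contMDiffAt_chart_symm_comp hφ (contDiffAt_fst (𝕜 := ℝ) (n := ω)
    (p := (φ 1, φ 1))) he
  have hb := contMDiffAt_chart_symm_comp hφ (contDiffAt_snd (𝕜 := ℝ) (n := ω)
    (p := (φ 1, φ 1))) he
  have hF : ContMDiffAt 𝓘(ℝ, EuclideanSpace ℝ (Fin r) × EuclideanSpace ℝ (Fin r)) (𝓡 r) ω F
      (φ 1, φ 1) :=
    ((ha.moufang_mul hb).moufang_mul ha.moufang_inv).moufang_mul hb.moufang_inv
  have hF1' : F (φ 1, φ 1) ∈ φ.source := by rwa [hF1]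
  have hq : ContDiffAt ℝ ∞ (fun z => φ (F z)) (φ 1, φ 1) := contDiffAt_chart_comp hφ hF hF1'
  have hev1 := hF.continuousAt.eventually (φ.open_source.mem_nhds hF1')
  have hev2 := (ContinuousAt.moufang_mul r hF.continuousAt hb.continuousAt).eventually
    (φ.open_source.mem_nhds (by simpa only [hF1, h1, MoufangLoop.mul_one']))
  obtain ⟨A, hA, hA'⟩ := h.hasFDerivAt_commutator hq (Eventually.of_forall fun x => by rw [hF1])
    (by
      filter_upwards [hev1, hev2] with z hz1 hz2
      simp only [chartMul, φ.left_inv hz1, φ.left_inv hz2]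
      simp only [F, MoufangLoop.inv_mul_cancel_right']) (EuclideanSpace.single k 1)
  have line := fun l => hasDerivAt_add_single (φ 1) l
  have line0 : ∀ l : Fin r, φ 1 + EuclideanSpace.single l (0 : ℝ) = φ 1 := fun l => by simp
  have hdiff : ∀ᶠ s : ℝ in 𝓝 0, DifferentiableAt ℝ (fun z => φ (F z))
      (φ 1 + EuclideanSpace.single j s, φ 1) := by
    have h2 := (hq.of_le (m := 1) (by norm_cast)).eventually (by simp)
    have h3 : Tendsto (fun s : ℝ => (φ 1 + EuclideanSpace.single j s, φ 1)) (𝓝 0)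
        (𝓝 (φ 1, φ 1)) := by
      have := (line j).continuousAt.prodMk (continuousAt_const (y := φ 1))
      rwa [ContinuousAt, line0] at this
    exact (h3.eventually h2).mono fun x hx => hx.differentiableAt one_ne_zero
  -- The inner derivative is identified only for small `s`, which is all the outer derivative sees.
  have inner_deriv : (fun s : ℝ => deriv (fun t : ℝ =>
      φ (coordPoint φ j s * coordPoint φ k t * (coordPoint φ j s)⁻¹ * (coordPoint φ k t)⁻¹) i) 0)
      =ᶠ[𝓝 0] fun s => fderiv ℝ (fun z => φ (F z)) (φ 1 + EuclideanSpace.single j s, φ 1)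
        (0, EuclideanSpace.single k 1) i := by
    filter_upwards [hdiff] with s hs
    have hs' : HasFDerivAt (fun z => φ (F z))
        (fderiv ℝ (fun z => φ (F z)) (φ 1 + EuclideanSpace.single j s, φ 1))
        (φ 1 + EuclideanSpace.single j s, φ 1 + EuclideanSpace.single k 0) := by
      rw [line0]
      exact hs.hasFDerivAt
    have := HasFDerivAt.comp_hasDerivAt
      (f := fun t : ℝ => (φ 1 + EuclideanSpace.single j s, φ 1 + EuclideanSpace.single k t))
      (0 : ℝ) hs' ((hasDerivAt_const (0 : ℝ) _).prodMk (line k))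
    exact ((EuclideanSpace.proj (𝕜 := ℝ) i).hasFDerivAt.comp_hasDerivAt (0 : ℝ) this).deriv
  rw [structureConstant, inner_deriv.deriv_eq]
  have hA2 : HasFDerivAt (fun x => fderiv ℝ (fun z => φ (F z)) (x, φ 1)
      (0, EuclideanSpace.single k 1)) A (φ 1 + EuclideanSpace.single j 0) := by
    rwa [line0]
  rw [← hA']
  exact ((EuclideanSpace.proj (𝕜 := ℝ) i).hasFDerivAt.comp_hasDerivAt (0 : ℝ)
    (hA2.comp_hasDerivAt (0 : ℝ) (line j))).deriv

end Chart

/-! ### Generators of birepresentations of analytic Moufang loops -/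

section Generators

open Filter Topology

attribute [local instance] Matrix.linftyOpNormedRing Matrix.linftyOpNormedAlgebra
  LieRing.ofAssociativeRing

variable {r n : ℕ} {G : Type*} [TopologicalSpace G]
  {φ : OpenPartialHomeomorph G (EuclideanSpace ℝ (Fin r))} {S T : G → GL (Fin n) ℂ}

theorem differentiableAt_of_entries {E : Type*} [NormedAddCommGroup E] [NormedSpace ℝ E]
    {F : E → Matrix (Fin n) (Fin n) ℂ} {x : E}
    (hF : ∀ A B, DifferentiableAt ℝ (fun y => F y A B) x) : DifferentiableAt ℝ F x := by
  have h1 : F = fun y => ∑ A, ∑ B, F y A B • Matrix.single A B (1 : ℂ) := by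
    funext y
    conv_lhs => rw [Matrix.matrix_eq_sum_single (F y)]
    simp
  rw [h1]
  exact DifferentiableAt.fun_sum fun A _ => DifferentiableAt.fun_sum fun B _ =>
    (hF A B).smul_const _

theorem generator_eq_fderiv [One G]
    (hS : DifferentiableAt ℝ (fun y => (S (φ.symm y) : Matrix (Fin n) (Fin n) ℂ)) (φ 1))
    (j : Fin r) : generator φ S j =
      fderiv ℝ (fun y => (S (φ.symm y) : Matrix (Fin n) (Fin n) ℂ)) (φ 1)
        (EuclideanSpace.single j 1) := by
  ext A B
  have line0 : φ 1 + EuclideanSpace.single j (0 : ℝ) = φ 1 := by simp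
  have h1 : HasFDerivAt (fun y => (S (φ.symm y) : Matrix (Fin n) (Fin n) ℂ))
      (fderiv ℝ (fun y => (S (φ.symm y) : Matrix (Fin n) (Fin n) ℂ)) (φ 1))
      (φ 1 + EuclideanSpace.single j (0 : ℝ)) := by
    rw [line0]
    exact hS.hasFDerivAt
  have h2 := h1.comp_hasDerivAt (0 : ℝ) (hasDerivAt_add_single (φ 1) j)
  let ε : Matrix (Fin n) (Fin n) ℂ →L[ℝ] ℂ :=
    LinearMap.toContinuousLinearMap (Matrix.entryLinearMap ℝ ℂ A B)
  exact (ε.hasFDerivAt.comp_hasDerivAt (0 : ℝ) h2).deriv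

theorem linearCombination_generator [One G]
    (hS : DifferentiableAt ℝ (fun y => (S (φ.symm y) : Matrix (Fin n) (Fin n) ℂ)) (φ 1)) :
    Fintype.linearCombination ℝ (generator φ S) =
      (fderiv ℝ (fun y => (S (φ.symm y) : Matrix (Fin n) (Fin n) ℂ)) (φ 1) :
        EuclideanSpace ℝ (Fin r) →ₗ[ℝ] Matrix (Fin n) (Fin n) ℂ) ∘ₗ
        (WithLp.linearEquiv 2 ℝ (Fin r → ℝ)).symm.toLinearMap := by
  refine LinearMap.pi_ext' fun j => LinearMap.ext_ring ?_
  simp only [LinearMap.comp_apply, LinearMap.coe_single, ContinuousLinearMap.coe_coe,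
    Fintype.linearCombination_apply_single, one_smul, generator_eq_fderiv hS]
  rfl

variable [ChartedSpace (EuclideanSpace ℝ (Fin r)) G]

theorem IsDifferentiableMap.differentiableAt_chart (hS : IsDifferentiableMap r S)
    [IsManifold (𝓡 r) ω G] (hφ : φ ∈ IsManifold.maximalAtlas (𝓡 r) ω G)
    {x : EuclideanSpace ℝ (Fin r)} (hx : x ∈ φ.target) :
    DifferentiableAt ℝ (fun y => (S (φ.symm y) : Matrix (Fin n) (Fin n) ℂ)) x := by
  refine differentiableAt_of_entries fun A B => ?_
  have h1 : MDifferentiableAt (𝓡 r) (𝓡 r) φ.symm x :=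
    ((contMDiffOn_symm_of_mem_maximalAtlas hφ).contMDiffAt
      (φ.open_target.mem_nhds hx)).mdifferentiableAt (by simp)
  exact mdifferentiableAt_iff_differentiableAt.1 (MDifferentiableAt.comp x (hS A B (φ.symm x)) h1)

variable [MoufangLoop G] [IsAnalyticMoufangLoop r G]

/-- Both sides are bilinear, so it suffices to compare them on basis vectors. -/
theorem symm_bracketOf_structureConstant (hφ : φ ∈ IsManifold.maximalAtlas (𝓡 r) ω G)
    (hφ1 : (1 : G) ∈ φ.source) (x y : Fin r → ℝ) :
    (WithLp.linearEquiv 2 ℝ (Fin r → ℝ)).symm (bracketLinear (structureConstant φ) x y) =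
      tangentProduct (chartMul φ) (φ 1) ((WithLp.linearEquiv 2 ℝ (Fin r → ℝ)).symm x)
        ((WithLp.linearEquiv 2 ℝ (Fin r → ℝ)).symm y) := by
  let ι := (WithLp.linearEquiv 2 ℝ (Fin r → ℝ)).symm
  have : (bracketLinear (structureConstant φ)).compr₂ ι.toLinearMap =
      (tangentProduct (chartMul φ) (φ 1)).compl₁₂ ι.toLinearMap ι.toLinearMap := by
    refine LinearMap.pi_ext' fun j => LinearMap.ext_ring (LinearMap.pi_ext' fun k =>
      LinearMap.ext_ring ?_)
    ext i
    simp only [LinearMap.comp_apply, LinearMap.compr₂_apply, LinearMap.compl₁₂_apply,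
      LinearMap.coe_single, bracketLinear_single]
    exact structureConstant_eq_tangentProduct hφ hφ1 i j k
  exact congrArg (fun B : (Fin r → ℝ) →ₗ[ℝ] (Fin r → ℝ) →ₗ[ℝ] EuclideanSpace ℝ (Fin r) => B x y)
    this

/-- The tangent algebra of an analytic Moufang loop is a Mal'tsev algebra. -/
theorem isMaltsevBracket_structureConstant (hφ : φ ∈ IsManifold.maximalAtlas (𝓡 r) ω G)
    (hφ1 : (1 : G) ∈ φ.source) : IsMaltsevBracket (bracketOf (structureConstant φ)) := by
  have h := (isLocalMoufangLoop_chartMul hφ hφ1).isMaltsevBracket_tangentProduct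
  have e := symm_bracketOf_structureConstant hφ hφ1
  simp only [bracketLinear_apply] at e
  have inj := (WithLp.linearEquiv 2 ℝ (Fin r → ℝ)).symm.injective
  constructor
  · intro x y
    apply inj
    rw [map_neg, e, e]
    exact h.anticomm _ _
  · intro x y z
    apply inj
    have := h.maltsev ((WithLp.linearEquiv 2 ℝ (Fin r → ℝ)).symm x)
      ((WithLp.linearEquiv 2 ℝ (Fin r → ℝ)).symm y) ((WithLp.linearEquiv 2 ℝ (Fin r → ℝ)).symm z)
    simpa only [jacobian, e, map_add] using this

theorem isLocalBirepresentation_chart (hφ : φ ∈ IsManifold.maximalAtlas (𝓡 r) ω G)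
    (hφ1 : (1 : G) ∈ φ.source) (hST : IsBirepresentation S T) (hS : IsDifferentiableMap r S)
    (hT : IsDifferentiableMap r T) :
    IsLocalBirepresentation (chartMul φ) (φ 1)
      (fun y => (S (φ.symm y) : Matrix (Fin n) (Fin n) ℂ))
      (fun y => (T (φ.symm y) : Matrix (Fin n) (Fin n) ℂ)) := by
  have h1 : φ.symm (φ 1) = 1 := φ.left_inv hφ1
  have he : φ 1 ∈ φ.target := φ.map_source hφ1
  have hsymm : ContinuousAt φ.symm (φ 1) := φ.symm.continuousAt he
  have ha : ContinuousAt (fun z : EuclideanSpace ℝ (Fin r) × EuclideanSpace ℝ (Fin r) =>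
    φ.symm z.1) (φ 1, φ 1) := ContinuousAt.comp (g := φ.symm) hsymm continuousAt_fst
  have hb : ContinuousAt (fun z : EuclideanSpace ℝ (Fin r) × EuclideanSpace ℝ (Fin r) =>
    φ.symm z.2) (φ 1, φ 1) := ContinuousAt.comp (g := φ.symm) hsymm continuousAt_snd
  have hab : ∀ᶠ z : EuclideanSpace ℝ (Fin r) × EuclideanSpace ℝ (Fin r) in 𝓝 (φ 1, φ 1),
      φ.symm z.1 * φ.symm z.2 ∈ φ.source :=
    (ContinuousAt.moufang_mul r ha hb).eventually (φ.open_source.mem_nhds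
      (by simpa only [h1, MoufangLoop.mul_one']))
  have hba : ∀ᶠ z : EuclideanSpace ℝ (Fin r) × EuclideanSpace ℝ (Fin r) in 𝓝 (φ 1, φ 1),
      φ.symm z.2 * φ.symm z.1 ∈ φ.source :=
    (ContinuousAt.moufang_mul r hb ha).eventually (φ.open_source.mem_nhds
      (by simpa only [h1, MoufangLoop.mul_one']))
  have coe : ∀ A B : GL (Fin n) ℂ, A = B →
      (A : Matrix (Fin n) (Fin n) ℂ) = (B : Matrix (Fin n) (Fin n) ℂ) := fun A B h => by rw [h]
  refine ⟨?_, ?_, ?_, ?_, ?_, ?_, ?_, ?_⟩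
  · simp [h1, hST.left_one]
  · simp [h1, hST.right_one]
  · filter_upwards [φ.open_target.mem_nhds he] with q hq using hS.differentiableAt_chart hφ hq
  · filter_upwards [φ.open_target.mem_nhds he] with q hq using hT.differentiableAt_chart hφ hq
  · filter_upwards [hba] with z hz
    rw [symm_chartMul hz]
    exact coe _ _ (hST.left_mul _ _)
  · filter_upwards [hab] with z hz
    rw [symm_chartMul hz]
    exact coe _ _ (MoufangLoop.birepresentation_right_mul hST.left_one hST.right_one
      hST.left_mul hST.right_mul _ _)
  · filter_upwards [hab] with z hz
    rw [symm_chartMul hz]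
    exact coe _ _ (hST.right_mul _ _)
  · filter_upwards [hba] with z hz
    rw [symm_chartMul hz]
    exact coe _ _ (MoufangLoop.birepresentation_left_mul hST.left_one hST.right_one
      hST.left_mul hST.right_mul _ _)

/-- The generators of a differentiable birepresentation satisfy the translation relations. -/
theorem IsBirepresentation.isTranslationPair (hφ : φ ∈ IsManifold.maximalAtlas (𝓡 r) ω G)
    (hφ1 : (1 : G) ∈ φ.source) (hST : IsBirepresentation S T) (hS : IsDifferentiableMap r S)
    (hT : IsDifferentiableMap r T) :
    IsTranslationPair (bracketLinear (structureConstant φ))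
      (Fintype.linearCombination ℝ (generator φ S))
      (Fintype.linearCombination ℝ (generator φ T)) := by
  have he : φ 1 ∈ φ.target := φ.map_source hφ1
  rw [linearCombination_generator (hS.differentiableAt_chart hφ he),
    linearCombination_generator (hT.differentiableAt_chart hφ he)]
  exact ((isLocalBirepresentation_chart hφ hφ1 hST hS hT).isTranslationPair
    (isLocalMoufangLoop_chartMul hφ hφ1)).comp _ (symm_bracketOf_structureConstant hφ hφ1)

end Generators

end

/-! ### From the generators to the charges. -/

theorem mainTheorem1 {r n m : ℕ} {G : Type*} [TopologicalSpace G]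
    [ChartedSpace (EuclideanSpace ℝ (Fin r)) G] [MoufangLoop G] [IsAnalyticMoufangLoop r G]
    (φ : OpenPartialHomeomorph G (EuclideanSpace ℝ (Fin r)))
    (hφ : φ ∈ IsManifold.maximalAtlas (𝓡 r) ω G) (hφ1 : (1 : G) ∈ φ.source)
    (S T : G → GL (Fin n) ℂ) (hST : IsBirepresentation S T)
    (hS : IsDifferentiableMap r S) (hT : IsDifferentiableMap r T)
    {D : Type*} [NormedAddCommGroup D] [InnerProductSpace ℂ D]
    (stat : FieldStatistics) (u p : ℝ → Fin n → OperatorField m D)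
    (hETC : ∀ t, CanonicalETC stat (u t) (p t))
    (K : ℕ → SplittingKernel m) (hK : IsDeltaSequence K)
    (t : ℝ) (σ τ : Fin r → Module.End ℂ D)
    (hσ : ∀ j, IsNoetherCharge K (p t) (generator φ S j) (u t) (σ j))
    (hτ : ∀ j, IsNoetherCharge K (p t) (generator φ T j) (u t) (τ j)) :
    IsMaltsevBirepresentation (structureConstant φ) σ τ
      (yamagutian (structureConstant φ) σ τ) :=
  IsTranslationPair.isMaltsevBirepresentation (isMaltsevBracket_structureConstant hφ hφ1)
    ((hST.isTranslationPair hφ hφ1 hS hT).of_charges (hETC t) hK hσ hτ)
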